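/- Let $\mathbb{R}^{3,1}$ be $\mathbb{R}^4$ with $\langle x,y\rangle_L=-x_0y_0+x_1y_1+x_2y_2+x_3y_3$, let $\mathbb{H}^3=\{x:\langle x,x\rangle_L=-1,\ x_0>0\}$ with the induced metric, and let $B^3(r)\subset\mathbb{H}^3$ be the geodesic ball of radius $r$ centred at $p_0=(1,0,0,0)$. For $a>1/2$ put $A(s)=\sqrt{a\cosh(2s)+\tfrac12}$, $B(s)=\sqrt{a\cosh(2s)-\tfrac12}$, $\varphi(s)=\int_0^s\frac{\sqrt{a^2-1/4}}{A(t)^2B(t)}\,dt$ and $$\Phi_a(s,\theta)=\bigl(A(s)\cosh\varphi(s),\,A(s)\sinh\varphi(s),\,B(s)\cos\theta,\,B(s)\sin\theta\bigr)\in\mathbb{H}^3 ,\qquad (s,\theta)\in\mathbb{R}\times S^1 .$$ Let $g$ be the metric on $\mathbb{R}\times S^1$ induced by $\Phi_a$, and let $|\mathrm{II}|^2=|\mathrm{II}|^2(s)$ be the squared norm of the second fundamental form of $\Phi_a$ in $\mathbb{H}^3$. For $s_0>0$ both boundary circles of $\Phi_a([-s_0,s_0]\times S^1)$ lie on the geodesic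 sphere $\partial B^3(r)$ with $r=\operatorname{arccosh}(A(s_0)\cosh\varphi(s_0))$. For every $a>1/2$ there is exactly one $s_0=s_0(a)>0$ for which this annulus meets that sphere orthogonally along its boundary circles. Let $\Sigma_a=[-s_0,s_0]\times S^1$ be this free boundary annulus (the critical spherical catenoid) and $r(a)$ the corresponding radius. For $u\in C^\infty(\Sigma_a)$ (smooth up to the boundary) let $$S(u,u)=\int_{\Sigma_a}\bigl(|\nabla u|^2-(|\mathrm{II}|^2-2)u^2\bigr)\,dA-\coth(r(a))\int_{\partial\Sigma_a}u^2\,dL .$$ The Robin Morse index of $\Sigma_a$ in mode $|k|=1$ is the maximal dimension of a linear space of functions $u\in C^\infty(\Sigma_a)$ of the form $u(s,\theta)=f(s)\cos\theta+h(s)\sin\theta$ on which $S$ is negative definite. Then, for every $a>1/2$: 1. the Robin Morse index of $\Sigma_a$ in mode $|k|=1$ equals $2$; 2. the radial Sturm–Liouville problem $$f''+\frac{B'}{B}f'+\Bigl(|\mathrm{II}|^2-2-\frac1{B^2}\Bigr)f=-\mu f\ \text{ on }(-s_0,s_0),\qquad f'(\pm s_0)=\pm\coth(r(a))\,f(\pm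 s_0),$$ with $f$ of class $C^2$ on $[-s_0,s_0]$, has exactly one negative eigenvalue $\mu_0(a)<0$, its next eigenvalue is $\mu_1(a)=0$, and both of these eigenvalues are simple. -/

import Mathlib

open Real Set MeasureTheory
open scoped ContDiff

noncomputable section

namespace SphericalCatenoid

/-! ### The surface in the hyperboloid model

`ℍ³` is the sheet `x 0 > 0` of `{x | mink x x = -1}` in Lorentz space `ℝ^{3,1}`, with the metric
induced by `mink`; geodesic balls are centred at `p₀ = (1, 0, 0, 0)`, and the distance from `p₀`
to `x` is `arcosh (x 0)`. -/

/-- The Lorentz product of signature `(-, +, +, +)`. -/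
def mink (x y : Fin 4 → ℝ) : ℝ :=
  -(x 0 * y 0) + x 1 * y 1 + x 2 * y 2 + x 3 * y 3

/-- `A(s)`, with `A(s)² = a cosh 2s + 1/2`. -/
def A (a s : ℝ) : ℝ := √(a * cosh (2 * s) + 1 / 2)

/-- `B(s)`, with `B(s)² = a cosh 2s - 1/2`. -/
def B (a s : ℝ) : ℝ := √(a * cosh (2 * s) - 1 / 2)

/-- The angular profile `φ(s) = ∫₀ˢ √(a² - 1/4) / (A(t)² B(t)) dt`. -/
def phi (a s : ℝ) : ℝ := ∫ t in (0 : ℝ)..s, √(a ^ 2 - 1 / 4) / (A a t ^ 2 * B a t)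

/-- The immersion `Φ_a(s, θ)`, which is `2π`-periodic in `θ`. -/
def Phi (a s θ : ℝ) : Fin 4 → ℝ :=
  ![A a s * cosh (phi a s), A a s * sinh (phi a s), B a s * cos θ, B a s * sin θ]

/-- The coordinate tangent vectors: index `0` is `∂_s Φ`, index `1` is `∂_θ Φ`. -/
def tangent (a s θ : ℝ) : Fin 2 → Fin 4 → ℝ :=
  ![deriv (fun t => Phi a t θ) s, deriv (fun t => Phi a s t) θ]

/-- The second coordinate derivatives `∂_i ∂_j Φ`. -/
def secondDeriv (a s θ : ℝ) (i j : Fin 2) : Fin 4 → ℝ :=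
  ![deriv (fun t => tangent a t θ j) s, deriv (fun t => tangent a s t j) θ] i

/-- The induced metric `g_{ij} = ⟨∂_i Φ, ∂_j Φ⟩` in the coordinates `(s, θ)`. -/
def metric (a s θ : ℝ) : Matrix (Fin 2) (Fin 2) ℝ :=
  Matrix.of fun i j => mink (tangent a s θ i) (tangent a s θ j)

/-- The component of `v` that is tangent to `ℍ³` and normal to the surface at `Φ_a(s, θ)`:
subtract from `v` its component along `Φ` (recall `⟨Φ, Φ⟩ = -1`) and its component along the
surface. -/
def normalPart (a s θ : ℝ) (v : Fin 4 → ℝ) : Fin 4 → ℝ :=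
  v + mink v (Phi a s θ) • Phi a s θ
    - ∑ k, ∑ l, ((metric a s θ)⁻¹ k l * mink v (tangent a s θ k)) • tangent a s θ l

/-- The squared norm `|II|²(s, θ) = g^{ij} g^{kl} ⟨II_{ik}, II_{jl}⟩` of the second fundamental form
`II_{ij} = (∂_i ∂_j Φ)^⊥` of the surface in `ℍ³`. -/
def normSqII (a s θ : ℝ) : ℝ :=
  ∑ i, ∑ j, ∑ k, ∑ l, (metric a s θ)⁻¹ i j * (metric a s θ)⁻¹ k l *
    mink (normalPart a s θ (secondDeriv a s θ i k)) (normalPart a s θ (secondDeriv a s θ j l))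

/-- A normal of the surface in `ℍ³` at the point with coordinates `(s, θ)`. -/
def IsNormal (a s θ : ℝ) (ν : Fin 4 → ℝ) : Prop :=
  mink ν (Phi a s θ) = 0 ∧ ∀ i, mink ν (tangent a s θ i) = 0

/-- The gradient in `ℍ³` of the height `x ↦ x 0`. It is an outward normal of the geodesic sphere
around `p₀` through `x`, for `x ≠ p₀`. -/
def sphereNormal (x : Fin 4 → ℝ) : Fin 4 → ℝ := x 0 • x - ![1, 0, 0, 0]

/-- The half-length `s₀ > 0` is critical if the piece `[-s₀, s₀] × S¹` of the surface is orthogonal,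
along its boundary circles, to the geodesic sphere around `p₀` through them. -/
def IsFreeBoundary (a s₀ : ℝ) : Prop :=
  0 < s₀ ∧ ∀ s, s = s₀ ∨ s = -s₀ → ∀ θ ν, IsNormal a s θ ν →
    mink ν (sphereNormal (Phi a s θ)) = 0

/-- The radius of the geodesic ball, `arcosh (A(s₀) cosh φ(s₀))`. -/
def radius (a s₀ : ℝ) : ℝ := arcosh (A a s₀ * cosh (phi a s₀))

def coth (x : ℝ) : ℝ := cosh x / sinh x

/-! ### The second variation form and the index in mode `|k| = 1` -/

/-- `u`, a function of `(s, θ)`, is a smooth function on the annulus `[-s₀, s₀] × S¹`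
(smooth up to the boundary). -/
def IsSmooth (s₀ : ℝ) (u : ℝ → ℝ → ℝ) : Prop :=
  ContDiffOn ℝ ∞ (fun p : ℝ × ℝ => u p.1 p.2) (Icc (-s₀) s₀ ×ˢ univ) ∧
    ∀ s ∈ Icc (-s₀) s₀, ∀ θ, u s (θ + 2 * π) = u s θ

/-- On each parallel, `u` is a combination of the Fourier modes `cos θ` and `sin θ`. -/
def IsModeOne (s₀ : ℝ) (u : ℝ → ℝ → ℝ) : Prop :=
  ∀ s ∈ Icc (-s₀) s₀, ∃ c d : ℝ, ∀ θ, u s θ = c * cos θ + d * sin θ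

/-- The coordinate partial derivatives of `u`. -/
def partials (u : ℝ → ℝ → ℝ) (s θ : ℝ) : Fin 2 → ℝ :=
  ![deriv (fun t => u t θ) s, deriv (fun t => u s t) θ]

/-- `|∇u|² = g^{ij} ∂_i u ∂_j u`. -/
def gradSq (a : ℝ) (u : ℝ → ℝ → ℝ) (s θ : ℝ) : ℝ :=
  ∑ i, ∑ j, (metric a s θ)⁻¹ i j * partials u s θ i * partials u s θ j

/-- `∫_{∂Σ} u² dL`: the sum over the two boundary circles, with length element `√g_{θθ} dθ`. -/
def boundaryIntegral (a s₀ : ℝ) (u : ℝ → ℝ → ℝ) : ℝ :=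
  (∫ θ in (0 : ℝ)..2 * π, u s₀ θ ^ 2 * √(metric a s₀ θ 1 1)) +
    ∫ θ in (0 : ℝ)..2 * π, u (-s₀) θ ^ 2 * √(metric a (-s₀) θ 1 1)

/-- The second variation form
`S(u, u) = ∫_Σ (|∇u|² - (|II|² - 2) u²) dA - coth r ∫_{∂Σ} u² dL`, with `dA = √(det g) ds dθ`. -/
def secondVariation (a s₀ : ℝ) (u : ℝ → ℝ → ℝ) : ℝ :=
  (∫ s in (-s₀)..s₀, ∫ θ in (0 : ℝ)..2 * π,
      (gradSq a u s θ - (normSqII a s θ - 2) * u s θ ^ 2) * √((metric a s θ).det)) -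
    coth (radius a s₀) * boundaryIntegral a s₀ u

/-- The dimensions of the finite-dimensional spaces of smooth functions in mode `|k| = 1` on which
the second variation form is negative definite. (The values of `u` outside `[-s₀, s₀]` do not matter
here: the form of a function that vanishes on the annulus is `0`, so that the restriction to the
annulus is injective on such a space.) -/
def negativeDims (a s₀ : ℝ) : Set ℕ :=
  {n | ∃ W : Submodule ℝ (ℝ → ℝ → ℝ), FiniteDimensional ℝ W ∧ Module.finrank ℝ W = n ∧
    ∀ u ∈ W, IsSmooth s₀ u ∧ IsModeOne s₀ u ∧ (u ≠ 0 → secondVariation a s₀ u < 0)}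

/-- The Robin Morse index in mode `|k| = 1` equals `n`. -/
def HasModeOneIndex (a s₀ : ℝ) (n : ℕ) : Prop := IsGreatest (negativeDims a s₀) n

/-! ### The radial Sturm–Liouville problem -/

/-- `f`, twice differentiable on `[-s₀, s₀]` (one-sidedly at the ends), solves
`f'' + (B'/B) f' + (|II|² - 2 - 1/B²) f = -μ f`, that is,
`-(B f')' + B (2 + 1/B² - |II|²) f = μ B f`, with the Robin conditions
`f'(±s₀) = ± coth(r) f(±s₀)`. Since `|II|²` does not depend on `θ`, it is taken at `θ = 0`. -/
def IsRadialSolution (a s₀ μ : ℝ) (f : ℝ → ℝ) : Prop :=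
  ∃ f₁ f₂ : ℝ → ℝ,
    (∀ s ∈ Icc (-s₀) s₀, HasDerivWithinAt f (f₁ s) (Icc (-s₀) s₀) s) ∧
    (∀ s ∈ Icc (-s₀) s₀, HasDerivWithinAt f₁ (f₂ s) (Icc (-s₀) s₀) s) ∧
    (∀ s ∈ Icc (-s₀) s₀, f₂ s + deriv (B a) s / B a s * f₁ s +
      (normSqII a s 0 - 2 - 1 / B a s ^ 2) * f s = -μ * f s) ∧
    f₁ s₀ = coth (radius a s₀) * f s₀ ∧
    f₁ (-s₀) = -(coth (radius a s₀) * f (-s₀))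

/-- The eigenspace of `μ`, as a space of functions on `[-s₀, s₀]`. -/
def radialEigenspace (a s₀ μ : ℝ) : Submodule ℝ (Icc (-s₀) s₀ → ℝ) where
  carrier := {h | ∃ f : ℝ → ℝ, IsRadialSolution a s₀ μ f ∧ ∀ s : Icc (-s₀) s₀, h s = f s}
  zero_mem' := by
    refine ⟨0, ⟨0, 0, fun s _ => ?_, fun s _ => ?_, by simp, by simp, by simp⟩, by simp⟩
    · exact hasDerivWithinAt_const s _ (0 : ℝ)
    · exact hasDerivWithinAt_const s _ (0 : ℝ)
  add_mem' := by
    rintro h k ⟨f, ⟨f₁, f₂, hf, hf₁, he, hp, hm⟩, hh⟩ ⟨g, ⟨g₁, g₂, hg, hg₁, he', hp', hm'⟩, hk⟩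
    refine ⟨f + g, ⟨f₁ + g₁, f₂ + g₂, fun s hs => (hf s hs).add (hg s hs),
      fun s hs => (hf₁ s hs).add (hg₁ s hs), fun s hs => ?_, ?_, ?_⟩, fun s => ?_⟩
    · simp only [Pi.add_apply]
      linear_combination he s hs + he' s hs
    · simp only [Pi.add_apply]
      linear_combination hp + hp'
    · simp only [Pi.add_apply]
      linear_combination hm + hm'
    · simp [hh s, hk s]
  smul_mem' := by
    rintro c h ⟨f, ⟨f₁, f₂, hf, hf₁, he, hp, hm⟩, hh⟩
    refine ⟨c • f, ⟨c • f₁, c • f₂, fun s hs => (hf s hs).const_smul c,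
      fun s hs => (hf₁ s hs).const_smul c, fun s hs => ?_, ?_, ?_⟩, fun s => ?_⟩
    · simp only [Pi.smul_apply, smul_eq_mul]
      linear_combination c * he s hs
    · simp only [Pi.smul_apply, smul_eq_mul]
      linear_combination c * hp
    · simp only [Pi.smul_apply, smul_eq_mul]
      linear_combination c * hm
    · simp [hh s]

/-- The eigenvalues of the radial problem. -/
def radialSpectrum (a s₀ : ℝ) : Set ℝ := {μ | radialEigenspace a s₀ μ ≠ ⊥}

end SphericalCatenoid

end

open SphericalCatenoid

/-! Killing fields of hyperbolic space supply explicit Jacobi functions. With `T`, `N` the unit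
tangent and normal of the profile curve, the rotation in the `x₁x₂`-plane and the boost in the
`x₀x₂`-plane have normal components `tan₀ cos θ` and `tan₁ cos θ`. So `tan₀` and `tan₁` both solve
the radial equation in mode one with `μ = 0` (`isSol_tan₀`, `isSol_tan₁`). The first is odd and
vanishes only at `0`; the second is even and positive.

The surface is free boundary exactly when `nor₀ s₀ = 0`, and then `cosh r = A cosh φ` and `sinh r =
tan₀` at `s₀`. Rotations about `p₀` preserve the ball, so `tan₀` satisfies the Robin condition
(`robin_tan₀`). Boosts move `p₀`, and `tan₁` misses the condition with a definite sign
(`robin_tan₁_lt`).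

Index: integration by parts and that sign make the form negative on `tan₁ cos θ` and `tan₁ sin θ`.
If both radial coefficients vanish at `s = 0`, completing the square with `tan₀` on each half of the
annulus shows that the form is nonnegative (`half_form_nonneg`). These are two linear conditions, so
the index is exactly `2`.

Spectrum: for `ν ≥ 0` the even solution with `μ = -ν` is `tan₁ z`, with `z` given by a power series
in `ν`. Its Robin defect is positive at `ν = 0` and nonpositive for some large `ν`, and a Wronskian
argument allows only one zero. An odd eigenfunction with `μ < 0` is excluded by its Wronskian with
`tan₀`. Since the defect at `ν = 0` is nonzero, the zero eigenspace is spanned by `tan₀`. -/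

noncomputable section

namespace SphericalCatenoid

/-! ### The profile curve and its Frenet frame -/

/-- The constant `√(a² - 1/4)`. -/
def K (a : ℝ) : ℝ := √(a ^ 2 - 1 / 4)

/-- The components of the unit tangent of the profile curve. -/
def tan₀ (a s : ℝ) : ℝ :=
  a * sinh (2 * s) / A a s * cosh (phi a s) + K a / (A a s * B a s) * sinh (phi a s)

def tan₁ (a s : ℝ) : ℝ :=
  a * sinh (2 * s) / A a s * sinh (phi a s) + K a / (A a s * B a s) * cosh (phi a s)

/-- The components of the unit normal of the profile curve. -/
def nor₀ (a s : ℝ) : ℝ :=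
  K a / A a s * cosh (phi a s) - a * sinh (2 * s) / (A a s * B a s) * sinh (phi a s)

def nor₁ (a s : ℝ) : ℝ :=
  K a / A a s * sinh (phi a s) - a * sinh (2 * s) / (A a s * B a s) * cosh (phi a s)

/-- The principal curvature of the profile curve. -/
def curv (a s : ℝ) : ℝ := K a / B a s ^ 2

section
variable {a : ℝ} (ha : 1 / 2 < a) (s : ℝ)
include ha
theorem radicand_pos : 0 < a * cosh (2 * s) - 1 / 2 := by
  nlinarith [one_le_cosh (2 * s)]

theorem B_sq : B a s ^ 2 = a * cosh (2 * s) - 1 / 2 := sq_sqrt (radicand_pos ha s).le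

theorem A_sq : A a s ^ 2 = B a s ^ 2 + 1 := by
  rw [B_sq ha, A, sq_sqrt (by linarith [radicand_pos ha s])]; ring

theorem B_pos : 0 < B a s := sqrt_pos.2 (radicand_pos ha s)

theorem A_pos : 0 < A a s := sqrt_pos.2 (by linarith [radicand_pos ha s])

theorem K_pos : 0 < K a := sqrt_pos.2 (by nlinarith)

theorem K_sq : K a ^ 2 = a ^ 2 - 1 / 4 := sq_sqrt (by nlinarith)

/-- This is the unit speed condition in disguise. Together with `A_sq` it removes all even powers of
`A` and of `a sinh 2s` from the frame identities below. -/
theorem frame_relation : a ^ 2 * sinh (2 * s) ^ 2 = (B a s ^ 2 + 1) * B a s ^ 2 - K a ^ 2 := by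
  rw [K_sq ha, B_sq ha, sinh_sq]; ring

theorem hasDerivAt_B : HasDerivAt (B a) (a * sinh (2 * s) / B a s) s := by
  have h : HasDerivAt (fun s : ℝ => a * cosh (2 * s) - 1 / 2) (2 * (a * sinh (2 * s))) s := by
    have := ((((hasDerivAt_id s).const_mul 2).cosh).const_mul a).sub_const (1 / 2)
    exact this.congr_deriv (by simp; ring)
  refine (h.sqrt (radicand_pos ha s).ne').congr_deriv ?_
  rw [mul_div_mul_left _ _ two_ne_zero]; rfl

theorem hasDerivAt_A : HasDerivAt (A a) (a * sinh (2 * s) / A a s) s := by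
  have h : HasDerivAt (fun s : ℝ => a * cosh (2 * s) + 1 / 2) (2 * (a * sinh (2 * s))) s := by
    have := ((((hasDerivAt_id s).const_mul 2).cosh).const_mul a).add_const (1 / 2)
    exact this.congr_deriv (by simp; ring)
  refine (h.sqrt (by linarith [radicand_pos ha s])).congr_deriv ?_
  rw [mul_div_mul_left _ _ two_ne_zero]; rfl

omit s in
theorem continuous_A : Continuous (A a) :=
  continuous_iff_continuousAt.2 fun s => (hasDerivAt_A ha s).continuousAt

omit s in
theorem continuous_B : Continuous (B a) :=
  continuous_iff_continuousAt.2 fun s => (hasDerivAt_B ha s).continuousAt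

omit s in
theorem continuous_phi_integrand : Continuous fun t => K a / (A a t ^ 2 * B a t) :=
  continuous_const.div (((continuous_A ha).pow 2).mul (continuous_B ha)) fun s =>
    (mul_pos (pow_pos (A_pos ha s) 2) (B_pos ha s)).ne'

theorem hasDerivAt_phi : HasDerivAt (phi a) (K a / (A a s ^ 2 * B a s)) s :=
  intervalIntegral.integral_hasDerivAt_right
    ((continuous_phi_integrand ha).intervalIntegrable _ _)
    (continuous_phi_integrand ha).aestronglyMeasurable.stronglyMeasurableAtFilter
    (continuous_phi_integrand ha).continuousAt

theorem hasDerivAt_pos₀ : HasDerivAt (fun s => A a s * cosh (phi a s)) (tan₀ a s) s := by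
  have hA := (A_pos ha s).ne'
  have hB := (B_pos ha s).ne'
  refine ((hasDerivAt_A ha s).mul (hasDerivAt_phi ha s).cosh).congr_deriv ?_
  rw [tan₀]; field_simp

theorem hasDerivAt_pos₁ : HasDerivAt (fun s => A a s * sinh (phi a s)) (tan₁ a s) s := by
  have hA := (A_pos ha s).ne'
  have hB := (B_pos ha s).ne'
  refine ((hasDerivAt_A ha s).mul (hasDerivAt_phi ha s).sinh).congr_deriv ?_
  rw [tan₁]; field_simp

theorem hasDerivAt_aS : HasDerivAt (fun s : ℝ => a * sinh (2 * s)) (2 * B a s ^ 2 + 1) s := by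
  refine ((((hasDerivAt_id s).const_mul 2).sinh).const_mul a).congr_deriv ?_
  rw [B_sq ha]; simp; ring

/-- Frenet equation `T' = Φ + curv • N`: for a unit speed curve in the hyperboloid the position
vector appears because `⟨Φ, Φ⟩ = -1`. -/
theorem hasDerivAt_tan₀ :
    HasDerivAt (tan₀ a) (A a s * cosh (phi a s) + curv a s * nor₀ a s) s := by
  have hA := (A_pos ha s).ne'
  have hB := (B_pos ha s).ne'
  have h1 := (((hasDerivAt_aS ha s).div (hasDerivAt_A ha s) hA).mul (hasDerivAt_phi ha s).cosh).add
    (((hasDerivAt_const s (K a)).div ((hasDerivAt_A ha s).mul (hasDerivAt_B ha s))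
      (mul_ne_zero hA hB)).mul (hasDerivAt_phi ha s).sinh)
  refine h1.congr_deriv ?_
  simp only [curv, nor₀, Pi.mul_apply, Pi.div_apply]
  have e1 := A_sq ha s
  have e2 := frame_relation ha s
  -- With the functions made opaque, the identity is rational in them, and `e1`, `e2` are its only
  -- relations.
  generalize A a s = α at *
  generalize B a s = β at *
  generalize K a = κ at *
  generalize cosh (phi a s) = c at *
  generalize sinh (phi a s) = d at *
  generalize sinh (2 * s) = σ at *
  field_simp
  simp only [e1, e2]
  ring

theorem hasDerivAt_tan₁ :
    HasDerivAt (tan₁ a) (A a s * sinh (phi a s) + curv a s * nor₁ a s) s := by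
  have hA := (A_pos ha s).ne'
  have hB := (B_pos ha s).ne'
  have h1 := (((hasDerivAt_aS ha s).div (hasDerivAt_A ha s) hA).mul (hasDerivAt_phi ha s).sinh).add
    (((hasDerivAt_const s (K a)).div ((hasDerivAt_A ha s).mul (hasDerivAt_B ha s))
      (mul_ne_zero hA hB)).mul (hasDerivAt_phi ha s).cosh)
  refine h1.congr_deriv ?_
  simp only [curv, nor₁, Pi.mul_apply, Pi.div_apply]
  have e1 := A_sq ha s
  have e2 := frame_relation ha s
  generalize A a s = α at *
  generalize B a s = β at *
  generalize K a = κ at *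
  generalize cosh (phi a s) = c at *
  generalize sinh (phi a s) = d at *
  generalize sinh (2 * s) = σ at *
  field_simp
  simp only [e1, e2]
  ring

theorem hasDerivAt_aS_div_AB : HasDerivAt (fun s => a * sinh (2 * s) / (A a s * B a s))
    (K a ^ 2 * (2 * B a s ^ 2 + 1) / (A a s * B a s) ^ 3) s := by
  have hA := (A_pos ha s).ne'
  have hB := (B_pos ha s).ne'
  have h1 := (hasDerivAt_aS ha s).div ((hasDerivAt_A ha s).mul (hasDerivAt_B ha s))
      (mul_ne_zero hA hB)
  refine h1.congr_deriv ?_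
  simp only [Pi.mul_apply]
  have e1 := A_sq ha s
  have e2 := frame_relation ha s
  generalize A a s = α at *
  generalize B a s = β at *
  generalize K a = κ at *
  generalize sinh (2 * s) = σ at *
  field_simp
  simp only [e1, e2]
  ring

/-- Weingarten equation `N' = -curv • T`. It makes `nor₀` monotone wherever `tan₀` has a sign, hence
the uniqueness of `s₀`. -/
theorem hasDerivAt_nor₀ : HasDerivAt (nor₀ a) (-(curv a s * tan₀ a s)) s := by
  have hA := (A_pos ha s).ne'
  have hB := (B_pos ha s).ne'
  have h1 := (((hasDerivAt_const s (K a)).div (hasDerivAt_A ha s) hA).mul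
      (hasDerivAt_phi ha s).cosh).sub
    ((hasDerivAt_aS_div_AB ha s).mul (hasDerivAt_phi ha s).sinh)
  refine h1.congr_deriv ?_
  simp only [curv, tan₀, Pi.div_apply]
  have e1 := A_sq ha s
  generalize A a s = α at *
  generalize B a s = β at *
  generalize K a = κ at *
  generalize cosh (phi a s) = c at *
  generalize sinh (phi a s) = d at *
  generalize sinh (2 * s) = σ at *
  field_simp
  simp only [e1]
  ring

theorem hasDerivAt_nor₁ : HasDerivAt (nor₁ a) (-(curv a s * tan₁ a s)) s := by
  have hA := (A_pos ha s).ne'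
  have hB := (B_pos ha s).ne'
  have h1 := (((hasDerivAt_const s (K a)).div (hasDerivAt_A ha s) hA).mul
      (hasDerivAt_phi ha s).sinh).sub
    ((hasDerivAt_aS_div_AB ha s).mul (hasDerivAt_phi ha s).cosh)
  refine h1.congr_deriv ?_
  simp only [curv, tan₁, Pi.div_apply]
  have e1 := A_sq ha s
  generalize A a s = α at *
  generalize B a s = β at *
  generalize K a = κ at *
  generalize cosh (phi a s) = c at *
  generalize sinh (phi a s) = d at *
  generalize sinh (2 * s) = σ at *
  field_simp
  simp only [e1]
  ring

/-! ### Two solutions of the radial Jacobi equation -/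

/-- `p g'' + p' g' = p q g` on the whole line, as a first order system; `g₁` is the derivative. -/
def IsSol (p q g g₁ : ℝ → ℝ) : Prop :=
  ∀ s, HasDerivAt g (g₁ s) s ∧ HasDerivAt (fun t => p t * g₁ t) (p s * q s * g s) s

/-- The zeroth order coefficient `2 + 1/B² - |II|²` of the Jacobi operator in mode one. -/
def pot (a s : ℝ) : ℝ := 2 + 1 / B a s ^ 2 - 2 * K a ^ 2 / B a s ^ 4

/-- `tan₀ = x₁ N₂ - x₂ N₁` along the profile, the normal component of the rotation in the
`x₁x₂`-plane; Killing fields give Jacobi functions. -/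
theorem isSol_tan₀ : IsSol (B a) (pot a) (tan₀ a)
    (fun s => A a s * cosh (phi a s) + curv a s * nor₀ a s) := by
  intro s
  refine ⟨hasDerivAt_tan₀ ha s, ?_⟩
  have hA := (A_pos ha s).ne'
  have hB := (B_pos ha s).ne'
  have h1 := (hasDerivAt_B ha s).mul ((hasDerivAt_pos₀ ha s).add
    (((hasDerivAt_const s (K a)).div ((hasDerivAt_B ha s).pow 2) (pow_ne_zero 2 hB)).mul
      (hasDerivAt_nor₀ ha s)))
  refine h1.congr_deriv ?_
  simp only [curv, tan₀, nor₀, pot, Pi.mul_apply, Pi.div_apply, Pi.add_apply, Pi.pow_apply]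
  have e1 := A_sq ha s
  have e2 := frame_relation ha s
  generalize A a s = α at *
  generalize B a s = β at *
  generalize K a = κ at *
  generalize cosh (phi a s) = c at *
  generalize sinh (phi a s) = d at *
  generalize sinh (2 * s) = σ at *
  field_simp
  simp only [e1]
  linear_combination β * κ * d * e2

/-- `tan₁ = x₀ N₂ - x₂ N₀` along the profile, the normal component of the boost in the `x₀x₂`-plane.
-/
theorem isSol_tan₁ : IsSol (B a) (pot a) (tan₁ a)
    (fun s => A a s * sinh (phi a s) + curv a s * nor₁ a s) := by
  intro s
  refine ⟨hasDerivAt_tan₁ ha s, ?_⟩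
  have hA := (A_pos ha s).ne'
  have hB := (B_pos ha s).ne'
  have h1 := (hasDerivAt_B ha s).mul ((hasDerivAt_pos₁ ha s).add
    (((hasDerivAt_const s (K a)).div ((hasDerivAt_B ha s).pow 2) (pow_ne_zero 2 hB)).mul
      (hasDerivAt_nor₁ ha s)))
  refine h1.congr_deriv ?_
  simp only [curv, tan₁, nor₁, pot, Pi.mul_apply, Pi.div_apply, Pi.add_apply, Pi.pow_apply]
  have e1 := A_sq ha s
  have e2 := frame_relation ha s
  generalize A a s = α at *
  generalize B a s = β at *
  generalize K a = κ at *
  generalize cosh (phi a s) = c at *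
  generalize sinh (phi a s) = d at *
  generalize sinh (2 * s) = σ at *
  field_simp
  simp only [e1]
  linear_combination β * κ * c * e2

end

/-! ### Parity and sign -/

theorem A_neg (a s : ℝ) : A a (-s) = A a s := by simp [A]

theorem B_neg (a s : ℝ) : B a (-s) = B a s := by simp [B]

theorem phi_neg (a s : ℝ) : phi a (-s) = -phi a s := by
  have h := intervalIntegral.integral_comp_neg (a := 0) (b := s)
    (fun t => √(a ^ 2 - 1 / 4) / (A a t ^ 2 * B a t))
  simp only [A_neg, B_neg, neg_zero] at h
  rw [phi, phi, h, intervalIntegral.integral_symm]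

theorem phi_zero (a : ℝ) : phi a 0 = 0 := by simp [phi]

theorem tan₀_neg (a s : ℝ) : tan₀ a (-s) = -tan₀ a s := by
  simp only [tan₀, A_neg, B_neg, phi_neg, mul_neg, sinh_neg, cosh_neg]; ring

theorem tan₁_neg (a s : ℝ) : tan₁ a (-s) = tan₁ a s := by
  simp only [tan₁, A_neg, B_neg, phi_neg, mul_neg, sinh_neg, cosh_neg]; ring

theorem nor₀_neg (a s : ℝ) : nor₀ a (-s) = nor₀ a s := by
  simp only [nor₀, A_neg, B_neg, phi_neg, mul_neg, sinh_neg, cosh_neg]; ring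

theorem pot_neg (a s : ℝ) : pot a (-s) = pot a s := by
  simp only [pot, B_neg]

theorem phi_strictMono {a : ℝ} (ha : 1 / 2 < a) : StrictMono (phi a) :=
  strictMono_of_hasDerivAt_pos (hasDerivAt_phi ha) fun s =>
    div_pos (K_pos ha) (mul_pos (pow_pos (A_pos ha s) 2) (B_pos ha s))

theorem phi_pos {a : ℝ} (ha : 1 / 2 < a) {s : ℝ} (hs : 0 < s) : 0 < phi a s := by
  simpa [phi_zero] using phi_strictMono ha hs

theorem tan₀_pos {a : ℝ} (ha : 1 / 2 < a) {s : ℝ} (hs : 0 < s) : 0 < tan₀ a s := by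
  have hA := A_pos ha s
  have hB := B_pos ha s
  have hK := K_pos ha
  have h1 : 0 < sinh (phi a s) := sinh_pos_iff.2 (phi_pos ha hs)
  have h2 : 0 < sinh (2 * s) := sinh_pos_iff.2 (by linarith)
  have h3 := cosh_pos (phi a s)
  have h4 : 0 < a := by linarith
  unfold tan₀
  positivity

theorem tan₁_pos {a : ℝ} (ha : 1 / 2 < a) (s : ℝ) : 0 < tan₁ a s := by
  wlog hs : 0 ≤ s generalizing s
  · rw [← tan₁_neg]; exact this (-s) (by linarith)
  have hA := A_pos ha s
  have hB := B_pos ha s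
  have hK := K_pos ha
  have h1 : 0 ≤ sinh (phi a s) := by
    have := (phi_strictMono ha).monotone hs
    rw [phi_zero] at this
    exact sinh_nonneg_iff.2 this
  have h2 : 0 ≤ sinh (2 * s) := sinh_nonneg_iff.2 (by linarith)
  have h3 := cosh_pos (phi a s)
  have h4 : 0 < a := by linarith
  unfold tan₁
  positivity

/-! ### The frame of the surface and the second fundamental form -/

def frameT (a s θ : ℝ) : Fin 4 → ℝ :=
  ![tan₀ a s, tan₁ a s, a * sinh (2 * s) / B a s * cos θ, a * sinh (2 * s) / B a s * sin θ]

/-- This is the coordinate vector `∂_θ Φ`, of length `B`; unlike `frameT` and `frameN` it is not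
normalised. -/
def frameE (a s θ : ℝ) : Fin 4 → ℝ := ![0, 0, -(B a s * sin θ), B a s * cos θ]

def frameN (a s θ : ℝ) : Fin 4 → ℝ :=
  ![nor₀ a s, nor₁ a s, K a / B a s * cos θ, K a / B a s * sin θ]

theorem hasDerivAt_vec {f₀ f₁ f₂ f₃ : ℝ → ℝ} {d₀ d₁ d₂ d₃ s : ℝ} (h₀ : HasDerivAt f₀ d₀ s)
    (h₁ : HasDerivAt f₁ d₁ s) (h₂ : HasDerivAt f₂ d₂ s) (h₃ : HasDerivAt f₃ d₃ s) :
    HasDerivAt (fun t => ![f₀ t, f₁ t, f₂ t, f₃ t]) ![d₀, d₁, d₂, d₃] s := by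
  rw [hasDerivAt_pi]
  intro i
  fin_cases i
  exacts [h₀, h₁, h₂, h₃]

section
variable {a : ℝ} (ha : 1 / 2 < a) (s θ : ℝ)
include ha

theorem tangent_eq : tangent a s θ = ![frameT a s θ, frameE a s θ] := by
  have h0 : HasDerivAt (fun t => Phi a t θ) (frameT a s θ) s :=
    hasDerivAt_vec (hasDerivAt_pos₀ ha s) (hasDerivAt_pos₁ ha s)
      ((hasDerivAt_B ha s).mul_const _) ((hasDerivAt_B ha s).mul_const _)
  have h1 : HasDerivAt (fun t => Phi a s t) (frameE a s θ) θ := by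
    refine (hasDerivAt_vec (hasDerivAt_const θ _) (hasDerivAt_const θ _)
      ((hasDerivAt_cos θ).const_mul _) ((hasDerivAt_sin θ).const_mul _)).congr_deriv ?_
    simp [frameE]
  rw [tangent, h0.deriv, h1.deriv]

theorem hasDerivAt_tan₂ : HasDerivAt (fun s => a * sinh (2 * s) / B a s)
    (B a s + curv a s * (K a / B a s)) s := by
  have hB := (B_pos ha s).ne'
  refine ((hasDerivAt_aS ha s).div (hasDerivAt_B ha s) hB).congr_deriv ?_
  have e2 := frame_relation ha s
  rw [curv]
  field_simp
  rw [e2]; ring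

theorem secondDeriv_zero_zero :
    secondDeriv a s θ 0 0 = Phi a s θ + curv a s • frameN a s θ := by
  have h : HasDerivAt (fun t => frameT a t θ) (Phi a s θ + curv a s • frameN a s θ) s := by
    refine (hasDerivAt_vec (hasDerivAt_tan₀ ha s) (hasDerivAt_tan₁ ha s)
      ((hasDerivAt_tan₂ ha s).mul_const (cos θ))
      ((hasDerivAt_tan₂ ha s).mul_const (sin θ))).congr_deriv ?_
    ext i
    fin_cases i <;> simp [Phi, frameN] <;> ring
  simpa [secondDeriv, tangent_eq ha] using h.deriv

theorem secondDeriv_zero_one :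
    secondDeriv a s θ 0 1 = (a * sinh (2 * s) / B a s ^ 2) • frameE a s θ := by
  have hB := (B_pos ha s).ne'
  have h : HasDerivAt (fun t => frameE a t θ)
      ((a * sinh (2 * s) / B a s ^ 2) • frameE a s θ) s := by
    refine (hasDerivAt_vec (hasDerivAt_const s _) (hasDerivAt_const s _)
      ((hasDerivAt_B ha s).mul_const _).neg ((hasDerivAt_B ha s).mul_const _)).congr_deriv ?_
    ext i
    fin_cases i <;> simp [frameE] <;> field_simp
  simpa [secondDeriv, tangent_eq ha] using h.deriv

theorem secondDeriv_one_zero :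
    secondDeriv a s θ 1 0 = (a * sinh (2 * s) / B a s ^ 2) • frameE a s θ := by
  have hB := (B_pos ha s).ne'
  have h : HasDerivAt (fun t => frameT a s t)
      ((a * sinh (2 * s) / B a s ^ 2) • frameE a s θ) θ := by
    refine (hasDerivAt_vec (hasDerivAt_const θ _) (hasDerivAt_const θ _)
      ((hasDerivAt_cos θ).const_mul _) ((hasDerivAt_sin θ).const_mul _)).congr_deriv ?_
    ext i
    fin_cases i <;> simp [frameE] <;> field_simp
  simpa [secondDeriv, tangent_eq ha] using h.deriv

theorem secondDeriv_one_one :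
    secondDeriv a s θ 1 1 = B a s ^ 2 • Phi a s θ - (a * sinh (2 * s)) • frameT a s θ
      - K a • frameN a s θ := by
  have hA := (A_pos ha s).ne'
  have hB := (B_pos ha s).ne'
  have e1 := A_sq ha s
  have e2 := frame_relation ha s
  have h : HasDerivAt (fun t => frameE a s t)
      (B a s ^ 2 • Phi a s θ - (a * sinh (2 * s)) • frameT a s θ - K a • frameN a s θ) θ := by
    refine (hasDerivAt_vec (hasDerivAt_const θ _) (hasDerivAt_const θ _)
      ((hasDerivAt_sin θ).const_mul _).neg ((hasDerivAt_cos θ).const_mul _)).congr_deriv ?_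
    ext i
    fin_cases i <;> simp [Phi, frameT, frameN, tan₀, tan₁, nor₀, nor₁] <;> field_simp
    · linear_combination B a s * cosh (phi a s) * e2 - B a s ^ 3 * cosh (phi a s) * e1
    · linear_combination B a s * sinh (phi a s) * e2 - B a s ^ 3 * sinh (phi a s) * e1
    · linear_combination cos θ * e2
    · linear_combination sin θ * e2
  simpa [secondDeriv, tangent_eq ha] using h.deriv

end

/-! ### Bilinearity of the Lorentz product and orthogonality of the frame. -/

theorem mink_comm (x y : Fin 4 → ℝ) : mink x y = mink y x := by
  simp only [mink]; ring

theorem mink_add_left (x y z : Fin 4 → ℝ) : mink (x + y) z = mink x z + mink y z := by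
  simp only [mink, Pi.add_apply]; ring

theorem mink_sub_left (x y z : Fin 4 → ℝ) : mink (x - y) z = mink x z - mink y z := by
  simp only [mink, Pi.sub_apply]; ring

theorem mink_smul_left (c : ℝ) (x z : Fin 4 → ℝ) : mink (c • x) z = c * mink x z := by
  simp only [mink, Pi.smul_apply, smul_eq_mul]; ring

theorem mink_smul_right (c : ℝ) (x z : Fin 4 → ℝ) : mink x (c • z) = c * mink x z := by
  rw [mink_comm, mink_smul_left, mink_comm]

theorem mink_sub_right (x y z : Fin 4 → ℝ) : mink x (y - z) = mink x y - mink x z := by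
  rw [mink_comm, mink_sub_left, mink_comm y, mink_comm z]

section
variable {a : ℝ} (ha : 1 / 2 < a) (s θ : ℝ)
include ha

theorem mink_Phi_Phi : mink (Phi a s θ) (Phi a s θ) = -1 := by
  simp only [mink, Phi, Matrix.cons_val]
  linear_combination (-A a s ^ 2) * cosh_sq (phi a s) + B a s ^ 2 * sin_sq_add_cos_sq θ -
    A_sq ha s

theorem mink_Phi_frameT : mink (Phi a s θ) (frameT a s θ) = 0 := by
  have hA := (A_pos ha s).ne'
  have hB := (B_pos ha s).ne'
  simp only [mink, Phi, frameT, tan₀, tan₁, Matrix.cons_val]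
  field_simp
  linear_combination (-B a s * a * sinh (2 * s)) * cosh_sq (phi a s) +
    B a s * a * sinh (2 * s) * sin_sq_add_cos_sq θ

omit ha in
theorem mink_Phi_frameE : mink (Phi a s θ) (frameE a s θ) = 0 := by
  simp only [mink, Phi, frameE, Matrix.cons_val]
  ring

theorem mink_Phi_frameN : mink (Phi a s θ) (frameN a s θ) = 0 := by
  have hA := (A_pos ha s).ne'
  have hB := (B_pos ha s).ne'
  simp only [mink, Phi, frameN, nor₀, nor₁, Matrix.cons_val]
  field_simp
  linear_combination (-B a s * K a) * cosh_sq (phi a s) +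
    B a s * K a * sin_sq_add_cos_sq θ

theorem mink_frameT_frameT : mink (frameT a s θ) (frameT a s θ) = 1 := by
  have hA := (A_pos ha s).ne'
  have hB := (B_pos ha s).ne'
  have e1 := A_sq ha s
  have e2 := frame_relation ha s
  simp only [mink, frameT, tan₀, tan₁, Matrix.cons_val]
  have h1 := cosh_sq (phi a s)
  have h2 := sin_sq_add_cos_sq θ
  field_simp
  linear_combination (K a ^ 2 - (a * sinh (2 * s)) ^ 2 * B a s ^ 2) * h1 +
    (a * sinh (2 * s)) ^ 2 * A a s ^ 2 * h2 + ((a * sinh (2 * s)) ^ 2 - B a s ^ 2) * e1 + e2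

theorem mink_frameT_frameN : mink (frameT a s θ) (frameN a s θ) = 0 := by
  have hA := (A_pos ha s).ne'
  have hB := (B_pos ha s).ne'
  have e1 := A_sq ha s
  have e2 := frame_relation ha s
  simp only [mink, frameT, frameN, tan₀, tan₁, nor₀, nor₁, Matrix.cons_val]
  have h1 := cosh_sq (phi a s)
  have h2 := sin_sq_add_cos_sq θ
  field_simp
  linear_combination -(a * sinh (2 * s)) * K a * (B a s ^ 2 + 1) * h1 +
    (a * sinh (2 * s)) * A a s ^ 2 * K a * h2 + (a * sinh (2 * s)) * K a * e1

theorem mink_frameN_frameN : mink (frameN a s θ) (frameN a s θ) = 1 := by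
  have hA := (A_pos ha s).ne'
  have hB := (B_pos ha s).ne'
  have e1 := A_sq ha s
  have e2 := frame_relation ha s
  simp only [mink, frameN, nor₀, nor₁, Matrix.cons_val]
  have h1 := cosh_sq (phi a s)
  have h2 := sin_sq_add_cos_sq θ
  field_simp
  linear_combination ((a * sinh (2 * s)) ^ 2 - K a ^ 2 * B a s ^ 2) * h1 +
    K a ^ 2 * A a s ^ 2 * h2 + (K a ^ 2 - B a s ^ 2) * e1 + e2

omit ha in
theorem mink_frameT_frameE : mink (frameT a s θ) (frameE a s θ) = 0 := by
  simp only [mink, frameT, frameE, Matrix.cons_val]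
  ring

omit ha in
theorem mink_frameE_frameE : mink (frameE a s θ) (frameE a s θ) = B a s ^ 2 := by
  simp only [mink, frameE, Matrix.cons_val]
  linear_combination B a s ^ 2 * sin_sq_add_cos_sq θ

omit ha in
theorem mink_frameE_frameN : mink (frameE a s θ) (frameN a s θ) = 0 := by
  simp only [mink, frameN, frameE, Matrix.cons_val]
  ring

theorem metric_eq : metric a s θ = !![1, 0; 0, B a s ^ 2] := by
  ext i j
  fin_cases i <;> fin_cases j <;>
    simp [metric, tangent_eq ha, mink_frameT_frameT ha, mink_frameT_frameE, mink_frameE_frameE,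
      mink_comm (frameE a s θ) (frameT a s θ)]

theorem metric_inv : (metric a s θ)⁻¹ = !![1, 0; 0, 1 / B a s ^ 2] := by
  have hB := (B_pos ha s).ne'
  apply Matrix.inv_eq_right_inv
  rw [metric_eq ha]
  ext i j
  fin_cases i <;> fin_cases j <;> simp [Matrix.mul_apply, hB]

theorem det_metric : (metric a s θ).det = B a s ^ 2 := by
  simp [metric_eq ha, Matrix.det_fin_two]

theorem normalPart_eq (v : Fin 4 → ℝ) :
    normalPart a s θ v = v + mink v (Phi a s θ) • Phi a s θ
      - (mink v (frameT a s θ) • frameT a s θ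
        + (1 / B a s ^ 2 * mink v (frameE a s θ)) • frameE a s θ) := by
  simp [normalPart, metric_inv ha, tangent_eq ha, Fin.sum_univ_two]

/-- Raising an index with the inverse metric gives principal curvatures `K/B²` and `-K/B²`: the
surface is minimal and `|II|² = 2K²/B⁴`. -/
theorem normalPart_secondDeriv (i j : Fin 2) :
    normalPart a s θ (secondDeriv a s θ i j)
      = !![curv a s, 0; 0, -K a] i j • frameN a s θ := by
  have hB := (B_pos ha s).ne'
  have e1 := mink_comm (frameT a s θ) (Phi a s θ)
  have e2 := mink_comm (frameE a s θ) (Phi a s θ)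
  have e3 := mink_comm (frameN a s θ) (Phi a s θ)
  have e4 := mink_comm (frameE a s θ) (frameT a s θ)
  have e5 := mink_comm (frameN a s θ) (frameT a s θ)
  have e6 := mink_comm (frameN a s θ) (frameE a s θ)
  fin_cases i <;> fin_cases j <;>
    simp [normalPart_eq ha, secondDeriv_zero_zero ha, secondDeriv_zero_one ha,
      secondDeriv_one_zero ha, secondDeriv_one_one ha, mink_add_left, mink_sub_left,
      mink_smul_left, mink_Phi_Phi ha, mink_Phi_frameT ha, mink_Phi_frameE, mink_Phi_frameN ha,
      mink_frameT_frameT ha, mink_frameT_frameE, mink_frameT_frameN ha, mink_frameE_frameE,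
      mink_frameE_frameN, e1, e2, e3, e4, e5, e6]
  · rw [← sub_smul, sub_eq_zero.2, zero_smul]
    field_simp
  · rw [← sub_smul, sub_eq_zero.2, zero_smul]
    field_simp
  · abel

theorem normSqII_eq : normSqII a s θ = 2 * K a ^ 2 / B a s ^ 4 := by
  have hB := (B_pos ha s).ne'
  simp only [normSqII, normalPart_secondDeriv ha, metric_inv ha, mink_smul_left, mink_smul_right,
    mink_frameN_frameN ha]
  simp [Fin.sum_univ_two, curv]
  field_simp
  ring

/-- The height vector `e₀` in terms of the frame. -/
theorem height_eq : ![1, 0, 0, 0] = (A a s * cosh (phi a s)) • Phi a s θ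
    - tan₀ a s • frameT a s θ - nor₀ a s • frameN a s θ := by
  have hA := (A_pos ha s).ne'
  have hB := (B_pos ha s).ne'
  have e1 := A_sq ha s
  have e2 := frame_relation ha s
  have h1 := cosh_sq (phi a s)
  ext i
  fin_cases i <;> simp [Phi, frameT, frameN, tan₀, tan₁, nor₀, nor₁] <;> field_simp
  · linear_combination (cosh (phi a s) ^ 2 * B a s ^ 2 + sinh (phi a s) ^ 2) * e2 -
      A a s ^ 2 * B a s ^ 2 * cosh (phi a s) ^ 2 * e1 -
      B a s ^ 2 * (cosh (phi a s) ^ 2 * B a s ^ 2 + sinh (phi a s) ^ 2) * e1 - A a s ^ 2 * B a s ^ 2 * h1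
  · linear_combination cosh (phi a s) * sinh (phi a s) * (B a s ^ 2 + 1) * e2 -
      cosh (phi a s) * sinh (phi a s) * B a s ^ 2 * (B a s ^ 2 + 1 + A a s ^ 2) * e1
  · linear_combination cos θ * cosh (phi a s) * B a s * (e2 - B a s ^ 2 * e1)
  · linear_combination sin θ * cosh (phi a s) * B a s * (e2 - B a s ^ 2 * e1)

end

/-! ### The free boundary condition -/

section
variable {a : ℝ} (ha : 1 / 2 < a)
include ha

/-- This is `⟨e₀, e₀⟩ = -1` expanded in the frame. Since `A cosh φ = cosh r`, the right side is
`sinh² r`. -/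
theorem frameT_height (s : ℝ) : tan₀ a s ^ 2 + nor₀ a s ^ 2 = (A a s * cosh (phi a s)) ^ 2 - 1 := by
  have h := congrFun (height_eq ha s 0) 0
  simp [Phi, frameT, frameN] at h
  linarith

theorem frameT_height_one (s : ℝ) : tan₀ a s * tan₁ a s + nor₀ a s * nor₁ a s =
    A a s * cosh (phi a s) * (A a s * sinh (phi a s)) := by
  have h := congrFun (height_eq ha s 0) 1
  simp [Phi, frameT, frameN] at h
  linarith

/-- A normal `ν` is orthogonal to `Φ`, so its product with the sphere normal is `-⟨ν, e₀⟩ = ν 0`;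
the normal line is spanned by `frameN`. -/
theorem isFreeBoundary_iff (s₀ : ℝ) : IsFreeBoundary a s₀ ↔ 0 < s₀ ∧ nor₀ a s₀ = 0 := by
  have key : ∀ s θ ν, IsNormal a s θ ν → mink ν (sphereNormal (Phi a s θ)) = ν 0 := by
    intro s θ ν h
    rw [sphereNormal, mink_sub_right, mink_smul_right, h.1]
    simp [mink]
  constructor
  · rintro ⟨h0, h⟩
    have hn : IsNormal a s₀ 0 (frameN a s₀ 0) := by
      refine ⟨by rw [mink_comm, mink_Phi_frameN ha], fun i => ?_⟩
      rw [tangent_eq ha]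
      fin_cases i
      · simp [mink_comm (frameN a s₀ 0), mink_frameT_frameN ha]
      · simp [mink_comm (frameN a s₀ 0), mink_frameE_frameN]
    have := h s₀ (Or.inl rfl) 0 _ hn
    rw [key _ _ _ hn] at this
    exact ⟨h0, this⟩
  · rintro ⟨h0, h⟩
    refine ⟨h0, fun s hs θ ν hn => ?_⟩
    have hN : nor₀ a s = 0 := by
      rcases hs with rfl | rfl
      · exact h
      · rw [nor₀_neg, h]
    rw [key _ _ _ hn]
    -- Pairing `ν` with the expansion of `e₀` leaves only the `frameN` term, whose coefficient is
    -- `nor₀ = 0`.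
    have e : mink ν ![1, 0, 0, 0] = -ν 0 := by simp [mink]
    have hT := hn.2 0
    rw [tangent_eq ha] at hT
    simp only [Matrix.cons_val_zero] at hT
    rw [height_eq ha s θ, mink_sub_right, mink_sub_right, mink_smul_right, mink_smul_right,
      mink_smul_right, hn.1, hT, hN] at e
    linarith

theorem nor₀_strictAntiOn : StrictAntiOn (nor₀ a) (Ici 0) := by
  refine strictAntiOn_of_deriv_neg (convex_Ici 0)
    (fun s _ => (hasDerivAt_nor₀ ha s).continuousAt.continuousWithinAt) fun s hs => ?_
  rw [interior_Ici] at hs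
  rw [(hasDerivAt_nor₀ ha s).deriv]
  have := mul_pos (div_pos (K_pos ha) (pow_pos (B_pos ha s) 2)) (tan₀_pos ha hs)
  simpa [curv] using this

/-- The sign of `nor₀` is that of `K B cosh φ - a sinh 2s sinh φ`. Here `B` grows like the square
root of `sinh 2s`, while `tanh φ(s)` stays above `tanh φ(1) > 0`, so the second term wins. -/
theorem exists_nor₀_nonpos : ∃ s, 0 < s ∧ nor₀ a s ≤ 0 := by
  set d₁ := sinh (phi a 1) with hd₁
  set c₁ := cosh (phi a 1) with hc₁
  have hd : 0 < d₁ := sinh_pos_iff.2 (phi_pos ha one_pos)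
  have hc : 0 < c₁ := cosh_pos _
  have ha0 : 0 < a := by linarith
  -- Chosen so that `sinh 2s ≥ 2s` yields `hbig`; the summand `1` ensures `φ(s) ≥ φ(1)`.
  set s := 1 + K a ^ 2 * c₁ ^ 2 / (a * d₁ ^ 2) with hs
  have hs1 : 1 ≤ s := by
    have : 0 ≤ K a ^ 2 * c₁ ^ 2 / (a * d₁ ^ 2) := by positivity
    linarith
  refine ⟨s, by linarith, ?_⟩
  have hA := A_pos ha s
  have hB := B_pos ha s
  have hS : 2 * s ≤ sinh (2 * s) := self_le_sinh_iff.2 (by linarith)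
  have hC : cosh (2 * s) ≤ 2 * sinh (2 * s) := by
    have := cosh_sub_sinh (2 * s)
    have : rexp (-(2 * s)) ≤ 1 := exp_le_one_iff.2 (by linarith)
    linarith
  have hBS : B a s ^ 2 ≤ 2 * (a * sinh (2 * s)) := by
    rw [B_sq ha]; nlinarith
  have hbig : 2 * (K a ^ 2 * c₁ ^ 2) ≤ a * sinh (2 * s) * d₁ ^ 2 := by
    have : K a ^ 2 * c₁ ^ 2 ≤ s * (a * d₁ ^ 2) := by
      rw [← div_le_iff₀ (by positivity)]; linarith
    nlinarith [mul_le_mul_of_nonneg_left hS (by positivity : 0 ≤ a * d₁ ^ 2)]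
  have hS0 : 0 < a * sinh (2 * s) := mul_pos ha0 (by linarith)
  have h1 : K a * B a s * c₁ ≤ a * sinh (2 * s) * d₁ := by
    have := K_pos ha
    refine abs_le_of_sq_le_sq' ?_ (by positivity) |>.2
    calc (K a * B a s * c₁) ^ 2 = K a ^ 2 * c₁ ^ 2 * B a s ^ 2 := by ring
      _ ≤ K a ^ 2 * c₁ ^ 2 * (2 * (a * sinh (2 * s))) := by gcongr
      _ = 2 * (K a ^ 2 * c₁ ^ 2) * (a * sinh (2 * s)) := by ring
      _ ≤ a * sinh (2 * s) * d₁ ^ 2 * (a * sinh (2 * s)) := by gcongr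
      _ = _ := by ring
  -- This is `tanh φ(s) ≥ tanh φ(1)` with denominators cleared.
  have h2 : 0 ≤ sinh (phi a s - phi a 1) :=
    sinh_nonneg_iff.2 (sub_nonneg.2 ((phi_strictMono ha).monotone hs1))
  rw [sinh_sub, ← hd₁, ← hc₁] at h2
  have h3 : K a * B a s * cosh (phi a s) ≤ a * sinh (2 * s) * sinh (phi a s) := by
    refine le_of_mul_le_mul_right ?_ hc
    calc K a * B a s * cosh (phi a s) * c₁ = K a * B a s * c₁ * cosh (phi a s) := by ring
      _ ≤ a * sinh (2 * s) * d₁ * cosh (phi a s) := by gcongr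
      _ = a * sinh (2 * s) * (cosh (phi a s) * d₁) := by ring
      _ ≤ a * sinh (2 * s) * (sinh (phi a s) * c₁) :=
        mul_le_mul_of_nonneg_left (by linarith) hS0.le
      _ = _ := by ring
  have h4 : nor₀ a s = (K a * B a s * cosh (phi a s) - a * sinh (2 * s) * sinh (phi a s))
      / (A a s * B a s) := by
    rw [nor₀]; field_simp
  rw [h4]
  exact div_nonpos_of_nonpos_of_nonneg (by linarith) (by positivity)

theorem existsUnique_isFreeBoundary : ∃! s₀, IsFreeBoundary a s₀ := by
  obtain ⟨s, hs, hn⟩ := exists_nor₀_nonpos ha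
  have h0 : 0 < nor₀ a 0 := by
    have := div_pos (K_pos ha) (A_pos ha 0)
    simpa [nor₀, phi_zero] using this
  have hcont : ContinuousOn (nor₀ a) (Icc 0 s) :=
    fun s _ => (hasDerivAt_nor₀ ha s).continuousAt.continuousWithinAt
  obtain ⟨x, hx, hx0⟩ := intermediate_value_Icc' hs.le hcont ⟨hn, h0.le⟩
  have hxpos : 0 < x := lt_of_le_of_ne hx.1 fun h => by rw [← h] at hx0; linarith
  refine ⟨x, (isFreeBoundary_iff ha x).2 ⟨hxpos, hx0⟩, fun y hy => ?_⟩
  obtain ⟨hy0, hy⟩ := (isFreeBoundary_iff ha y).1 hy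
  exact (nor₀_strictAntiOn ha).injOn hy0.le hxpos.le (hy.trans hx0.symm)

/-- At a free boundary `nor₀ = 0`, so `frameT_height` reads `sinh r = tan₀`. -/
theorem coth_radius {s₀ : ℝ} (h : IsFreeBoundary a s₀) :
    coth (radius a s₀) = A a s₀ * cosh (phi a s₀) / tan₀ a s₀ := by
  obtain ⟨hs, hN⟩ := (isFreeBoundary_iff ha s₀).1 h
  have hT := tan₀_pos ha hs
  have hA := A_pos ha s₀
  have h1 := frameT_height ha s₀
  have hy : 1 ≤ A a s₀ * cosh (phi a s₀) := by
    have : 1 ≤ (A a s₀ * cosh (phi a s₀)) ^ 2 := by nlinarith [sq_nonneg (tan₀ a s₀)]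
    exact (one_le_sq_iff₀ (by positivity)).1 this
  rw [coth, radius, cosh_arcosh hy, sinh_arcosh hy, ← h1, hN]
  congr 1
  rw [zero_pow two_ne_zero, add_zero, sqrt_sq hT.le]

/-- The odd radial Jacobi function satisfies the Robin condition. -/
theorem robin_tan₀ {s₀ : ℝ} (h : IsFreeBoundary a s₀) :
    A a s₀ * cosh (phi a s₀) + curv a s₀ * nor₀ a s₀ = coth (radius a s₀) * tan₀ a s₀ := by
  obtain ⟨hs, hN⟩ := (isFreeBoundary_iff ha s₀).1 h
  rw [coth_radius ha h, hN, div_mul_cancel₀ _ (tan₀_pos ha hs).ne']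
  ring

/-- The even radial Jacobi function fails the Robin condition with a sign. -/
theorem robin_tan₁_lt {s₀ : ℝ} (h : IsFreeBoundary a s₀) :
    A a s₀ * sinh (phi a s₀) + curv a s₀ * nor₁ a s₀ < coth (radius a s₀) * tan₁ a s₀ := by
  obtain ⟨hs, hN⟩ := (isFreeBoundary_iff ha s₀).1 h
  have hT := tan₀_pos ha hs
  have hA := A_pos ha s₀
  have hB := B_pos ha s₀
  have hK := K_pos ha
  have h1 := frameT_height ha s₀
  have h2 := frameT_height_one ha s₀
  have hsh : 0 < sinh (phi a s₀) := sinh_pos_iff.2 (phi_pos ha hs)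
  have hc := cosh_pos (phi a s₀)
  have hN1 : nor₁ a s₀ < 0 := by
    -- This combination cancels the `a sinh 2s` terms, so `nor₀ = 0` fixes the sign of `nor₁`.
    have e : nor₁ a s₀ * sinh (phi a s₀) = nor₀ a s₀ * cosh (phi a s₀) - K a / A a s₀ := by
      have := cosh_sq (phi a s₀)
      rw [nor₁, nor₀]
      field_simp
      linear_combination (-K a * B a s₀) * this
    rw [hN] at e
    have : 0 < K a / A a s₀ := by positivity
    nlinarith
  have hcurv : 0 < curv a s₀ := by unfold curv; positivity
  rw [hN] at h1 h2
  -- With `nor₀ = 0`, the frame gives `tan₀ tan₁ = A² cosh φ sinh φ` and `A² cosh² φ = 1 + tan₀²`.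
  -- The extra `1 / tan₀²` is a strict gain over `A sinh φ`.
  have e : coth (radius a s₀) * tan₁ a s₀ = A a s₀ * sinh (phi a s₀) * (1 + 1 / tan₀ a s₀ ^ 2) := by
    rw [coth_radius ha h]
    field_simp
    have h3 : tan₀ a s₀ ^ 2 + 1 = (A a s₀ * cosh (phi a s₀)) ^ 2 := by linarith
    rw [h3]
    linear_combination cosh (phi a s₀) * h2
  rw [e]
  have h5 : 0 < A a s₀ * sinh (phi a s₀) * (1 / tan₀ a s₀ ^ 2) := by positivity
  have h6 : curv a s₀ * nor₁ a s₀ < 0 := mul_neg_of_pos_of_neg hcurv hN1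
  linarith

end

/-! ### The entire family of solutions of `(w z')' = ν w z`, `z(0) = 1`, `z'(0) = 0` -/

/-- The coefficients of the power series in `ν` of the solution. -/
def iter (w : ℝ → ℝ) : ℕ → ℝ → ℝ
  | 0 => fun _ => 1
  | n + 1 => fun s => ∫ t in (0 : ℝ)..s, (∫ τ in (0 : ℝ)..t, w τ * iter w n τ) / w t

/-- Since `w (iter (n+1))' = moment n`, the coefficient of `ν^(n+1)` in `w z'` is `moment n`, whence
the shifted exponent in `flux`. -/
def moment (w : ℝ → ℝ) (n : ℕ) (t : ℝ) : ℝ := ∫ τ in (0 : ℝ)..t, w τ * iter w n τ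

/-- The solution `z` of the initial value problem. -/
def series (w : ℝ → ℝ) (ν s : ℝ) : ℝ := ∑' n : ℕ, ν ^ n * iter w n s

/-- The flux `w z'` of the solution. -/
def flux (w : ℝ → ℝ) (ν s : ℝ) : ℝ := ∑' n : ℕ, ν ^ (n + 1) * moment w n s

theorem hasDerivAt_integral {f : ℝ → ℝ} (hf : Continuous f) (s : ℝ) :
    HasDerivAt (fun t => ∫ τ in (0 : ℝ)..t, f τ) (f s) s :=
  intervalIntegral.integral_hasDerivAt_right (hf.intervalIntegrable _ _)
    hf.aestronglyMeasurable.stronglyMeasurableAtFilter hf.continuousAt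

theorem continuous_integral {f : ℝ → ℝ} (hf : Continuous f) :
    Continuous fun t => ∫ τ in (0 : ℝ)..t, f τ :=
  continuous_iff_continuousAt.2 fun s => (hasDerivAt_integral hf s).continuousAt

section
variable {w : ℝ → ℝ} (hw : Continuous w) (hp : ∀ s, 0 < w s)
include hw hp

theorem continuous_iter (n : ℕ) : Continuous (iter w n) := by
  induction n with
  | zero => exact continuous_const
  | succ n ih =>
    exact continuous_integral ((continuous_integral (hw.mul ih)).div hw fun s => (hp s).ne')

theorem hasDerivAt_moment (n : ℕ) (s : ℝ) :
    HasDerivAt (moment w n) (w s * iter w n s) s :=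
  hasDerivAt_integral (hw.mul (continuous_iter hw hp n)) s

theorem continuous_moment (n : ℕ) : Continuous (moment w n) :=
  continuous_integral (hw.mul (continuous_iter hw hp n))

theorem hasDerivAt_iter_succ (n : ℕ) (s : ℝ) :
    HasDerivAt (iter w (n + 1)) (moment w n s / w s) s :=
  hasDerivAt_integral ((continuous_moment hw hp n).div hw fun s => (hp s).ne') s

omit hw hp in
theorem moment_neg (he : ∀ s, w (-s) = w s) {n : ℕ} (h : ∀ s, iter w n (-s) = iter w n s)
    (s : ℝ) : moment w n (-s) = -moment w n s := by
  have := intervalIntegral.integral_comp_neg (a := 0) (b := s) (fun τ => w τ * iter w n τ)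
  simp only [he, h, neg_zero] at this
  rw [moment, moment, this, intervalIntegral.integral_symm]

omit hw hp in
theorem iter_neg (he : ∀ s, w (-s) = w s) (n : ℕ) (s : ℝ) : iter w n (-s) = iter w n s := by
  induction n generalizing s with
  | zero => rfl
  | succ n ih =>
    have := intervalIntegral.integral_comp_neg (a := 0) (b := s) (fun t => moment w n t / w t)
    simp only [he, moment_neg he ih, neg_zero, neg_div] at this
    rw [intervalIntegral.integral_neg] at this
    change ∫ t in (0 : ℝ)..-s, moment w n t / w t = ∫ t in (0 : ℝ)..s, moment w n t / w t
    rw [intervalIntegral.integral_symm, ← this, neg_neg]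

omit hw in
theorem iter_nonneg {n : ℕ} {s : ℝ} (hs : 0 ≤ s) : 0 ≤ iter w n s := by
  induction n generalizing s with
  | zero => exact zero_le_one
  | succ n ih =>
    refine intervalIntegral.integral_nonneg hs fun t ht => div_nonneg ?_ (hp t).le
    exact intervalIntegral.integral_nonneg ht.1 fun τ hτ => mul_nonneg (hp τ).le (ih hτ.1)

omit hw in
theorem moment_nonneg {n : ℕ} {s : ℝ} (hs : 0 ≤ s) : 0 ≤ moment w n s :=
  intervalIntegral.integral_nonneg hs fun τ hτ => mul_nonneg (hp τ).le (iter_nonneg hp hτ.1)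

/-- The inner integral is bounded crudely by a factor `M R`; only the outer one is computed exactly.
That already produces `1/n!`, enough for convergence at every `ν`. -/
theorem iter_moment_le {R m M : ℝ} (hR : 0 < R) (hm : 0 < m)
    (hb : ∀ s ∈ Icc 0 R, m ≤ w s ∧ w s ≤ M) (n : ℕ) {s : ℝ} (hs : s ∈ Icc 0 R) :
    iter w n s ≤ (M * R / m) ^ n * s ^ n / n.factorial ∧
      moment w n s ≤ M * R * ((M * R / m) ^ n * s ^ n / n.factorial) := by
  have hM : 0 < M := hm.trans_le ((hb 0 ⟨le_rfl, hR.le⟩).1.trans (hb 0 ⟨le_rfl, hR.le⟩).2)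
  have step : ∀ n, (∀ s ∈ Icc 0 R, iter w n s ≤ (M * R / m) ^ n * s ^ n / n.factorial) →
      ∀ s ∈ Icc 0 R, moment w n s ≤ M * R * ((M * R / m) ^ n * s ^ n / n.factorial) := by
    intro n h s hs
    have hs0 : 0 ≤ s := hs.1
    have h1 : moment w n s ≤ ∫ _ in (0 : ℝ)..s, M * ((M * R / m) ^ n * s ^ n / n.factorial) := by
      refine intervalIntegral.integral_mono_on hs.1
        ((hw.mul (continuous_iter hw hp n)).intervalIntegrable _ _)
        intervalIntegrable_const fun t ht => ?_
      have ht' : t ∈ Icc 0 R := ⟨ht.1, ht.2.trans hs.2⟩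
      have := ht.1
      refine mul_le_mul (hb t ht').2 ((h t ht').trans ?_) (iter_nonneg hp ht.1) hM.le
      gcongr
      exact ht.2
    rw [intervalIntegral.integral_const, sub_zero, smul_eq_mul] at h1
    refine h1.trans ?_
    rw [← mul_assoc, mul_comm s M]
    gcongr
    exact hs.2
  have main : ∀ n, ∀ s ∈ Icc 0 R, iter w n s ≤ (M * R / m) ^ n * s ^ n / n.factorial := by
    intro n
    induction n with
    | zero => intro s _; simp [iter]
    | succ n ih =>
      intro s hs
      have h1 : iter w (n + 1) s ≤
          ∫ t in (0 : ℝ)..s, (M * R / m) ^ (n + 1) / n.factorial * t ^ n := by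
        refine intervalIntegral.integral_mono_on hs.1
          (((continuous_moment hw hp n).div hw fun s => (hp s).ne').intervalIntegrable _ _)
          (Continuous.intervalIntegrable (by fun_prop) _ _) fun t ht => ?_
        have ht' : t ∈ Icc 0 R := ⟨ht.1, ht.2.trans hs.2⟩
        rw [div_le_iff₀ (hp t)]
        have h3 : 0 ≤ (M * R / m) ^ (n + 1) / n.factorial * t ^ n := by
          have := ht.1; positivity
        refine (step n ih t ht').trans (le_trans (le_of_eq ?_)
          (mul_le_mul_of_nonneg_left (hb t ht').1 h3))
        rw [pow_succ (M * R / m)]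
        field_simp
      refine h1.trans (le_of_eq ?_)
      rw [intervalIntegral.integral_const_mul, integral_pow, Nat.factorial_succ]
      push_cast
      field_simp
      ring
  exact ⟨main n s hs, step n (main n) s hs⟩

theorem exists_iter_bound (he : ∀ s, w (-s) = w s) {R : ℝ} (hR : 0 < R) :
    ∃ E C : ℝ, 0 ≤ E ∧ 0 ≤ C ∧ ∀ n : ℕ, ∀ s, |s| ≤ R →
      |iter w n s| ≤ E * (C ^ n / n.factorial) ∧ |moment w n s| ≤ E * (C ^ n / n.factorial) ∧
      |w s * iter w n s| ≤ E * (C ^ n / n.factorial) ∧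
      |moment w n s / w s| ≤ E * (C ^ n / n.factorial) := by
  obtain ⟨x, hx, hxm⟩ := isCompact_Icc.exists_isMinOn (nonempty_Icc.2 hR.le) hw.continuousOn
  obtain ⟨y, hy, hyM⟩ := isCompact_Icc.exists_isMaxOn (nonempty_Icc.2 hR.le) hw.continuousOn
  have hb : ∀ s ∈ Icc 0 R, w x ≤ w s ∧ w s ≤ w y := fun s hs => ⟨hxm hs, hyM hs⟩
  have hm := hp x
  have hM := hp y
  set m := w x
  set M := w y
  set C := M * R / m * R
  -- One summand for each of the four bounded quantities, so that a single majorant serves all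
  -- series.
  set E := 1 + M * R + M + M * R / m
  have hEC : ∀ n : ℕ, 0 ≤ C ^ n / n.factorial := fun n => by positivity
  have hE1 : 1 ≤ E := by
    have : 0 ≤ M * R + M + M * R / m := by positivity
    linarith
  refine ⟨E, C, by positivity, by positivity, fun n => ?_⟩
  have pos : ∀ s ∈ Icc 0 R,
      |iter w n s| ≤ E * (C ^ n / n.factorial) ∧ |moment w n s| ≤ E * (C ^ n / n.factorial) ∧
      |w s * iter w n s| ≤ E * (C ^ n / n.factorial) ∧
      |moment w n s / w s| ≤ E * (C ^ n / n.factorial) := by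
    intro s hs
    obtain ⟨h1, h2⟩ := iter_moment_le hw hp hR hm hb n hs
    have hsn : (M * R / m) ^ n * s ^ n / n.factorial ≤ C ^ n / n.factorial := by
      rw [← mul_pow]
      have := hs.1
      gcongr
      exact mul_le_mul_of_nonneg_left hs.2 (by positivity)
    have i0 := iter_nonneg hp (n := n) hs.1
    have m0 := moment_nonneg hp (n := n) hs.1
    have hi : iter w n s ≤ C ^ n / n.factorial := h1.trans hsn
    have hmo : moment w n s ≤ M * R * (C ^ n / n.factorial) :=
      h2.trans (mul_le_mul_of_nonneg_left hsn (by positivity))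
    have hMR : 0 ≤ M * R := by positivity
    have hMRm : 0 ≤ M * R / m := by positivity
    rw [abs_of_nonneg i0, abs_of_nonneg m0, abs_of_nonneg (mul_nonneg (hp s).le i0),
      abs_of_nonneg (div_nonneg m0 (hp s).le)]
    refine ⟨hi.trans (le_mul_of_one_le_left (hEC n) hE1), hmo.trans ?_, ?_, ?_⟩
    · exact mul_le_mul_of_nonneg_right (by linarith) (hEC n)
    · refine (mul_le_mul (hb s hs).2 hi i0 hM.le).trans ?_
      exact mul_le_mul_of_nonneg_right (by linarith) (hEC n)
    · refine (div_le_div₀ (by positivity) hmo hm (hb s hs).1).trans ?_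
      rw [mul_div_right_comm]
      exact mul_le_mul_of_nonneg_right (by linarith) (hEC n)
  intro s hs
  rcases le_total 0 s with h | h
  · exact pos s ⟨h, (le_abs_self s).trans hs⟩
  · have := pos (-s) ⟨by linarith, (neg_le_abs s).trans hs⟩
    rwa [iter_neg he, moment_neg he (iter_neg he n), he, abs_neg, neg_div, abs_neg] at this

omit hw hp in
theorem summable_majorant (E C x : ℝ) (k : ℕ) :
    Summable fun n : ℕ => x ^ (n + k) * (E * (C ^ n / n.factorial)) := by
  refine ((Real.summable_pow_div_factorial (x * C)).mul_left (x ^ k * E)).congr fun n => ?_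
  rw [mul_pow, pow_add]; ring

theorem summable_series (he : ∀ s, w (-s) = w s) (ν s : ℝ) :
    Summable fun n : ℕ => ν ^ n * iter w n s := by
  obtain ⟨E, C, -, -, h⟩ := exists_iter_bound hw hp he (R := |s| + 1) (by positivity)
  refine Summable.of_norm_bounded (summable_majorant E C |ν| 0) fun n => ?_
  rw [norm_mul, norm_pow]
  exact mul_le_mul_of_nonneg_left (h n s (by linarith)).1 (by positivity)

theorem summable_flux (he : ∀ s, w (-s) = w s) (ν s : ℝ) :
    Summable fun n : ℕ => ν ^ (n + 1) * moment w n s := by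
  obtain ⟨E, C, -, -, h⟩ := exists_iter_bound hw hp he (R := |s| + 1) (by positivity)
  refine Summable.of_norm_bounded (summable_majorant E C |ν| 1) fun n => ?_
  rw [norm_mul, norm_pow]
  exact mul_le_mul_of_nonneg_left (h n s (by linarith)).2.1 (by positivity)

theorem series_eq (he : ∀ s, w (-s) = w s) (ν s : ℝ) :
    series w ν s = 1 + ∑' n : ℕ, ν ^ (n + 1) * iter w (n + 1) s := by
  rw [series, (summable_series hw hp he ν s).tsum_eq_zero_add]
  simp [iter]

theorem hasDerivAt_series (he : ∀ s, w (-s) = w s) (ν s : ℝ) :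
    HasDerivAt (series w ν) (flux w ν s / w s) s := by
  obtain ⟨E, C, -, -, h⟩ := exists_iter_bound hw hp he (R := |s| + 1) (by positivity)
  have hmem : s ∈ Ioo (-(|s| + 1)) (|s| + 1) := abs_lt.1 (by linarith)
  have := hasDerivAt_tsum_of_isPreconnected (g := fun n s => ν ^ (n + 1) * iter w (n + 1) s)
    (g' := fun n s => ν ^ (n + 1) * (moment w n s / w s)) (summable_majorant E C |ν| 1)
    isOpen_Ioo isPreconnected_Ioo
    (fun n y _ => (hasDerivAt_iter_succ hw hp n y).const_mul _)
    (fun n y hy => by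
      rw [norm_mul, norm_pow]
      exact mul_le_mul_of_nonneg_left (h n y (abs_lt.2 hy).le).2.2.2 (by positivity)) hmem
    ((summable_nat_add_iff 1).2 (summable_series hw hp he ν s)) hmem
  have h2 := this.const_add 1
  rw [show series w ν = _ from funext (series_eq hw hp he ν)]
  refine h2.congr_deriv ?_
  rw [flux, ← tsum_div_const]
  simp_rw [mul_div_assoc]

theorem hasDerivAt_flux (he : ∀ s, w (-s) = w s) (ν s : ℝ) :
    HasDerivAt (flux w ν) (ν * w s * series w ν s) s := by
  obtain ⟨E, C, -, -, h⟩ := exists_iter_bound hw hp he (R := |s| + 1) (by positivity)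
  have hmem : s ∈ Ioo (-(|s| + 1)) (|s| + 1) := abs_lt.1 (by linarith)
  have := hasDerivAt_tsum_of_isPreconnected (g := fun n s => ν ^ (n + 1) * moment w n s)
    (g' := fun n s => ν ^ (n + 1) * (w s * iter w n s)) (summable_majorant E C |ν| 1)
    isOpen_Ioo isPreconnected_Ioo
    (fun n y _ => (hasDerivAt_moment hw hp n y).const_mul _)
    (fun n y hy => by
      rw [norm_mul, norm_pow]
      exact mul_le_mul_of_nonneg_left (h n y (abs_lt.2 hy).le).2.2.1 (by positivity)) hmem
    (summable_flux hw hp he ν s) hmem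
  refine this.congr_deriv ?_
  rw [series, ← tsum_mul_left]
  exact tsum_congr fun n => by ring

theorem one_le_series (he : ∀ s, w (-s) = w s) {ν : ℝ} (hν : 0 ≤ ν) (s : ℝ) :
    1 ≤ series w ν s := by
  have h0 : ∀ t, 0 ≤ t → 1 ≤ series w ν t := fun t ht => by
    rw [series_eq hw hp he]
    have : 0 ≤ ∑' n : ℕ, ν ^ (n + 1) * iter w (n + 1) t :=
      tsum_nonneg fun n => mul_nonneg (pow_nonneg hν _) (iter_nonneg hp ht)
    linarith
  rcases le_total 0 s with h | h
  · exact h0 s h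
  · have := h0 (-s) (by linarith)
    simpa [series, iter_neg he] using this

omit hw hp in
theorem series_neg (he : ∀ s, w (-s) = w s) (ν s : ℝ) : series w ν (-s) = series w ν s := by
  simp [series, iter_neg he]

omit hw hp in
theorem flux_neg (he : ∀ s, w (-s) = w s) (ν s : ℝ) : flux w ν (-s) = -flux w ν s := by
  simp [flux, moment_neg he (iter_neg he _), tsum_neg]

omit hw in
theorem flux_nonneg {ν : ℝ} (hν : 0 ≤ ν) {s : ℝ} (hs : 0 ≤ s) : 0 ≤ flux w ν s :=
  tsum_nonneg fun _ => mul_nonneg (pow_nonneg hν _) (moment_nonneg hp hs)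

omit hw hp in
theorem flux_zero_left (s : ℝ) : flux w 0 s = 0 := by simp [flux]

theorem continuousOn_series_flux (he : ∀ s, w (-s) = w s) (s N : ℝ) :
    ContinuousOn (fun ν => series w ν s) (Icc 0 N) ∧
      ContinuousOn (fun ν => flux w ν s) (Icc 0 N) := by
  obtain ⟨E, C, hE, hC, h⟩ := exists_iter_bound hw hp he (R := |s| + 1) (by positivity)
  have hn : ∀ ν ∈ Icc 0 N, ∀ k : ℕ, |ν| ^ k ≤ N ^ k := fun ν hν k =>
    pow_le_pow_left₀ (abs_nonneg ν) (by rw [abs_of_nonneg hν.1]; exact hν.2) k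
  constructor
  · refine continuousOn_tsum (fun n => by fun_prop) (summable_majorant E C N 0) fun n ν hν => ?_
    rw [norm_mul, norm_pow]
    exact mul_le_mul (hn ν hν n) (h n s (by linarith)).1 (abs_nonneg _)
      ((by positivity : 0 ≤ |ν| ^ n).trans (hn ν hν n))
  · refine continuousOn_tsum (fun n => by fun_prop) (summable_majorant E C N 1) fun n ν hν => ?_
    rw [norm_mul, norm_pow]
    exact mul_le_mul (hn ν hν _) (h n s (by linarith)).2.1 (abs_nonneg _)
      ((by positivity : 0 ≤ |ν| ^ (n + 1)).trans (hn ν hν _))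

/-- The logarithmic flux `w z' / z` at a point becomes arbitrarily large with `ν`. -/
theorem exists_le_flux (he : ∀ s, w (-s) = w s) {s₀ : ℝ} (hs₀ : 0 < s₀) {b : ℝ} (hb : 0 < b) :
    ∃ ν, 0 < ν ∧ b * series w ν s₀ ≤ flux w ν s₀ := by
  obtain ⟨x, hx, hxm⟩ := isCompact_Icc.exists_isMinOn (nonempty_Icc.2 hs₀.le) hw.continuousOn
  have hm := hp x
  set m := w x
  -- Suppose `w z' < b z(s₀)` at `s₀`. As `w z'` increases, `z' ≤ b z(s₀) / m` on `[0, s₀]`, so `z`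
  -- loses at most half of `z(s₀)` over a window of length `δ`.
  set δ := min s₀ (m / (2 * b)) with hδ
  have hδ0 : 0 < δ := lt_min hs₀ (by positivity)
  have hδs : δ ≤ s₀ := min_le_left _ _
  have hδb : 2 * b * δ ≤ m := by
    have : δ ≤ m / (2 * b) := min_le_right _ _
    rw [le_div_iff₀ (by positivity)] at this
    linarith
  -- On that window `(w z')' ≥ ν m z(s₀) / 2`, so this `ν` makes `w z'` grow by at least `b z(s₀)`,
  -- a contradiction.
  set ν := 2 * b / (m * δ) with hν
  have hν0 : 0 < ν := by positivity
  refine ⟨ν, hν0, ?_⟩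
  by_contra! hlt
  have hz := fun s => hasDerivAt_series hw hp he ν s
  have hv := fun s => hasDerivAt_flux hw hp he ν s
  have h1 := one_le_series hw hp he hν0.le
  have hmono : Monotone (flux w ν) := monotone_of_hasDerivAt_nonneg hv fun s =>
    mul_nonneg (mul_nonneg hν0.le (hp s).le) (by linarith [h1 s])
  have hhalf : ∀ t ∈ Ico (s₀ - δ) s₀, series w ν s₀ ≤ 2 * series w ν t := by
    intro t ht
    obtain ⟨ξ, hξ, e⟩ := exists_hasDerivAt_eq_slope (series w ν) _ ht.2
      (fun s _ => (hz s).continuousAt.continuousWithinAt) fun s _ => hz s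
    have hξ' : ξ ∈ Icc 0 s₀ := ⟨by linarith [hξ.1, ht.1], hξ.2.le⟩
    have hts : 0 < s₀ - t := by linarith [ht.2]
    rw [eq_div_iff hts.ne'] at e
    have h2 : flux w ν ξ / w ξ ≤ b * series w ν s₀ / m := by
      refine div_le_div₀ ?_ ((hmono hξ.2.le).trans hlt.le) hm (hxm hξ')
      have := h1 s₀
      positivity
    have h3 : b * series w ν s₀ / m * (s₀ - t) ≤ series w ν s₀ / 2 := by
      have hle : b * (s₀ - t) ≤ m / 2 := by nlinarith [ht.1]
      rw [div_mul_eq_mul_div, div_le_iff₀ hm]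
      nlinarith [h1 s₀]
    nlinarith [mul_le_mul_of_nonneg_right h2 hts.le]
  have hlt' : s₀ - δ < s₀ := by linarith
  obtain ⟨ξ, hξ, e⟩ := exists_hasDerivAt_eq_slope (flux w ν) _ hlt'
    (fun s _ => (hv s).continuousAt.continuousWithinAt) fun s _ => hv s
  have hξ' : ξ ∈ Icc 0 s₀ := ⟨by linarith [hξ.1], hξ.2.le⟩
  rw [eq_div_iff (by linarith)] at e
  have h4 : 0 ≤ flux w ν (s₀ - δ) := flux_nonneg hp hν0.le (by linarith)
  have h5 := hhalf ξ ⟨hξ.1.le, hξ.2⟩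
  have h6 : m ≤ w ξ := hxm hξ'
  have h7 : b * series w ν s₀ ≤ ν * w ξ * series w ν ξ * δ := by
    calc b * series w ν s₀ ≤ b * (2 * series w ν ξ) := by gcongr
      _ = ν * m * series w ν ξ * δ := by rw [hν]; field_simp
      _ ≤ _ := by
        have := h1 ξ
        gcongr
  have h8 : s₀ - (s₀ - δ) = δ := by ring
  rw [h8] at e
  linarith

end

/-! ### Wronskians -/

/-- `p g'' + p' g' = p q g` on the set `I`, as a first order system. -/
def IsSolOn (I : Set ℝ) (p q g g₁ : ℝ → ℝ) : Prop :=
  ∀ s ∈ I, HasDerivWithinAt g (g₁ s) I s ∧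
    HasDerivWithinAt (fun t => p t * g₁ t) (p s * q s * g s) I s

theorem IsSol.isSolOn {p q g g₁ : ℝ → ℝ} (h : IsSol p q g g₁) (I : Set ℝ) :
    IsSolOn I p q g g₁ := fun s _ => ⟨(h s).1.hasDerivWithinAt, (h s).2.hasDerivWithinAt⟩

theorem IsSolOn.mono {I J : Set ℝ} {p q g g₁ : ℝ → ℝ} (h : IsSolOn J p q g g₁) (hIJ : I ⊆ J) :
    IsSolOn I p q g g₁ := fun s hs => ⟨(h s (hIJ hs)).1.mono hIJ, (h s (hIJ hs)).2.mono hIJ⟩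

theorem IsSolOn.hasDerivWithinAt_wronskian {I : Set ℝ} {p q r f f₁ g g₁ : ℝ → ℝ}
    (hf : IsSolOn I p q f f₁) (hg : IsSolOn I p r g g₁) {s : ℝ} (hs : s ∈ I) :
    HasDerivWithinAt (fun t => p t * f₁ t * g t - f t * (p t * g₁ t))
      ((q s - r s) * (p s * f s * g s)) I s := by
  refine (((hf s hs).2.mul (hg s hs).1).sub ((hf s hs).1.mul (hg s hs).2)).congr_deriv ?_
  ring

theorem eq_of_hasDerivWithinAt_zero {x y : ℝ} {W : ℝ → ℝ}
    (h : ∀ s ∈ Icc x y, HasDerivWithinAt W 0 (Icc x y) s) {s : ℝ} (hs : s ∈ Icc x y) :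
    W s = W x :=
  constant_of_has_deriv_right_zero (fun s hs => (h s hs).continuousWithinAt)
    (fun s hs => (h s ⟨hs.1, hs.2.le⟩).mono_of_mem_nhdsWithin (Icc_mem_nhdsGE_of_mem hs)) s hs

theorem lt_of_hasDerivWithinAt_pos {x y : ℝ} (hxy : x < y) {W W' : ℝ → ℝ}
    (h : ∀ s ∈ Icc x y, HasDerivWithinAt W (W' s) (Icc x y) s)
    (hpos : ∀ s ∈ Ioo x y, 0 < W' s) : W x < W y := by
  refine strictMonoOn_of_hasDerivWithinAt_pos (f' := W') (convex_Icc x y)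
    (fun s hs => (h s hs).continuousWithinAt) (fun s hs => ?_) (fun s hs => ?_)
    ⟨le_rfl, hxy.le⟩ ⟨hxy.le, le_rfl⟩ hxy
  · exact (h s (interior_subset hs)).mono interior_subset
  · rw [interior_Icc] at hs; exact hpos s hs

/-- Variation of constants: all solutions in terms of a positive one. -/
theorem IsSolOn.eq_of_pos {s₀ : ℝ} (hs₀ : 0 < s₀) {p q f f₁ g g₁ : ℝ → ℝ} (hp : Continuous p)
    (hp0 : ∀ s, 0 < p s) (hf : IsSolOn (Icc (-s₀) s₀) p q f f₁) (hg : IsSol p q g g₁)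
    (hg0 : ∀ s, 0 < g s) {k : ℝ} (hk : p s₀ * f₁ s₀ * g s₀ - f s₀ * (p s₀ * g₁ s₀) = k) :
    p (-s₀) * f₁ (-s₀) * g (-s₀) - f (-s₀) * (p (-s₀) * g₁ (-s₀)) = k ∧
    ∃ α : ℝ, ∀ s ∈ Icc (-s₀) s₀,
      f s = α * g s + k * (g s * ∫ t in (0 : ℝ)..s, 1 / (p t * g t ^ 2)) := by
  have hW : ∀ s ∈ Icc (-s₀) s₀, p s * f₁ s * g s - f s * (p s * g₁ s) =
      p (-s₀) * f₁ (-s₀) * g (-s₀) - f (-s₀) * (p (-s₀) * g₁ (-s₀)) := fun s hs =>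
    eq_of_hasDerivWithinAt_zero (W := fun t => p t * f₁ t * g t - f t * (p t * g₁ t))
      (fun s hs => (hf.hasDerivWithinAt_wronskian (hg.isSolOn _) hs).congr_deriv (by ring)) hs
  have hk' := (hW s₀ ⟨by linarith, le_rfl⟩).symm.trans hk
  refine ⟨hk', ?_⟩
  have hgc : Continuous g := continuous_iff_continuousAt.2 fun s => (hg s).1.continuousAt
  have hJc : Continuous fun t => 1 / (p t * g t ^ 2) :=
    continuous_const.div (hp.mul (hgc.pow 2)) fun s =>
      (mul_pos (hp0 s) (pow_pos (hg0 s) 2)).ne'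
  -- Reduction of order: the constant Wronskian `k` gives `(f/g)' = k / (p g²)`.
  have hquot : ∀ s ∈ Icc (-s₀) s₀, HasDerivWithinAt
      (fun s => f s / g s - k * ∫ t in (0 : ℝ)..s, 1 / (p t * g t ^ 2)) 0 (Icc (-s₀) s₀) s := by
    intro s hs
    have h1 := hp0 s
    have h2 := hg0 s
    refine (((hf s hs).1.div (hg s).1.hasDerivWithinAt h2.ne').sub
      ((hasDerivAt_integral hJc s).hasDerivWithinAt.const_mul k)).congr_deriv ?_
    have h3 := (hW s hs).trans hk'
    field_simp
    linear_combination h3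
  refine ⟨f (-s₀) / g (-s₀) - k * ∫ t in (0 : ℝ)..-s₀, 1 / (p t * g t ^ 2), fun s hs => ?_⟩
  have h4 := eq_of_hasDerivWithinAt_zero hquot hs
  have h2 := (hg0 s).ne'
  rw [← h4]
  field_simp
  ring

/-! ### The radial problem -/

/-- The even solution of the radial equation with spectral parameter `-ν`. -/
def shoot (a ν s : ℝ) : ℝ := tan₁ a s * series (fun s => B a s * tan₁ a s ^ 2) ν s

/-- The last term is `tan₁ z'`, because `z' = flux / (B tan₁²)`. -/
def shootDeriv (a ν s : ℝ) : ℝ :=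
  (A a s * sinh (phi a s) + curv a s * nor₁ a s) * series (fun s => B a s * tan₁ a s ^ 2) ν s +
    flux (fun s => B a s * tan₁ a s ^ 2) ν s / (B a s * tan₁ a s)

theorem shoot_neg (a ν s : ℝ) : shoot a ν (-s) = shoot a ν s := by
  rw [shoot, shoot, tan₁_neg, series_neg fun s => by simp [B_neg, tan₁_neg]]

theorem nor₁_neg (a s : ℝ) : nor₁ a (-s) = -nor₁ a s := by
  simp only [nor₁, A_neg, B_neg, phi_neg, mul_neg, sinh_neg, cosh_neg]; ring

theorem shootDeriv_neg (a ν s : ℝ) : shootDeriv a ν (-s) = -shootDeriv a ν s := by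
  have he : ∀ s, B a (-s) * tan₁ a (-s) ^ 2 = B a s * tan₁ a s ^ 2 := fun s => by
    simp [B_neg, tan₁_neg]
  rw [shootDeriv, shootDeriv, series_neg he, flux_neg he]
  simp only [curv, tan₁_neg, nor₁_neg, A_neg, B_neg, phi_neg, sinh_neg]
  ring

theorem tan₀_zero (a : ℝ) : tan₀ a 0 = 0 := by simp [tan₀, phi_zero]

theorem coth_robin_neg (a s : ℝ) : A a (-s) * cosh (phi a (-s)) + curv a (-s) * nor₀ a (-s) =
    A a s * cosh (phi a s) + curv a s * nor₀ a s := by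
  simp only [curv, A_neg, B_neg, phi_neg, nor₀_neg, cosh_neg]

section
variable {a : ℝ} (ha : 1 / 2 < a)
include ha

theorem continuous_tan₁ : Continuous (tan₁ a) :=
  continuous_iff_continuousAt.2 fun s => (hasDerivAt_tan₁ ha s).continuousAt

theorem continuous_weight : Continuous fun s => B a s * tan₁ a s ^ 2 :=
  (continuous_B ha).mul ((continuous_tan₁ ha).pow 2)

theorem weight_pos (s : ℝ) : 0 < B a s * tan₁ a s ^ 2 :=
  mul_pos (B_pos ha s) (pow_pos (tan₁_pos ha s) 2)

omit ha in
theorem weight_neg (s : ℝ) : B a (-s) * tan₁ a (-s) ^ 2 = B a s * tan₁ a s ^ 2 := by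
  rw [B_neg, tan₁_neg]

theorem shoot_pos {ν : ℝ} (hν : 0 ≤ ν) (s : ℝ) : 0 < shoot a ν s :=
  mul_pos (tan₁_pos ha s) (one_pos.trans_le
    (one_le_series (continuous_weight ha) (weight_pos ha) weight_neg hν s))

/-- As `tan₁` solves the equation with `ν = 0`, the substitution `f = tan₁ z` turns `(B f')' = B
(pot + ν) f` into `(w z')' = ν w z` with `w = B tan₁²`. -/
theorem isSol_shoot (ν : ℝ) :
    IsSol (B a) (fun s => pot a s + ν) (shoot a ν) (shootDeriv a ν) := by
  intro s
  have hB := (B_pos ha s).ne'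
  have hT := (tan₁_pos ha s).ne'
  have h0 := hasDerivAt_series (continuous_weight ha) (weight_pos ha) weight_neg ν s
  have h1 := hasDerivAt_flux (continuous_weight ha) (weight_pos ha) weight_neg ν s
  have h2 := isSol_tan₁ ha s
  constructor
  · refine (h2.1.mul h0).congr_deriv ?_
    rw [shootDeriv]
    field_simp
  · have h3 : (fun t => B a t * shootDeriv a ν t) = fun t =>
        B a t * (A a t * sinh (phi a t) + curv a t * nor₁ a t) *
          series (fun s => B a s * tan₁ a s ^ 2) ν t +
        flux (fun s => B a s * tan₁ a s ^ 2) ν t / tan₁ a t := by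
      funext t
      have hB := (B_pos ha t).ne'
      have hT := (tan₁_pos ha t).ne'
      rw [shootDeriv]
      field_simp
    rw [h3]
    refine ((h2.2.mul h0).add (h1.div h2.1 hT)).congr_deriv ?_
    rw [shoot]
    field_simp
    ring

/-- The defect of the even solution in the Robin condition. -/
def defect (a s₀ ν : ℝ) : ℝ := coth (radius a s₀) * shoot a ν s₀ - shootDeriv a ν s₀

omit ha in
theorem defect_eq (s₀ ν : ℝ) : defect a s₀ ν =
    (coth (radius a s₀) * tan₁ a s₀ - (A a s₀ * sinh (phi a s₀) + curv a s₀ * nor₁ a s₀)) *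
      series (fun s => B a s * tan₁ a s ^ 2) ν s₀ -
    flux (fun s => B a s * tan₁ a s ^ 2) ν s₀ / (B a s₀ * tan₁ a s₀) := by
  rw [defect, shoot, shootDeriv]; ring

theorem defect_zero_pos {s₀ : ℝ} (h : IsFreeBoundary a s₀) : 0 < defect a s₀ 0 := by
  rw [defect_eq, flux_zero_left, zero_div, sub_zero]
  exact mul_pos (sub_pos.2 (robin_tan₁_lt ha h)) (one_pos.trans_le
    (one_le_series (continuous_weight ha) (weight_pos ha) weight_neg le_rfl s₀))

/-- Intermediate value theorem in `ν`: the defect is positive at `0`, and `exists_le_flux` makes it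
nonpositive at some `N`. -/
theorem exists_defect_eq_zero {s₀ : ℝ} (h : IsFreeBoundary a s₀) :
    ∃ ν, 0 < ν ∧ defect a s₀ ν = 0 := by
  have hB := B_pos ha s₀
  have hT := tan₁_pos ha s₀
  have h0 := defect_zero_pos ha h
  have hd := sub_pos.2 (robin_tan₁_lt ha h)
  obtain ⟨N, hN, hle⟩ := exists_le_flux (continuous_weight ha) (weight_pos ha) weight_neg h.1
    (mul_pos hd (mul_pos hB hT))
  have hcont : ContinuousOn (defect a s₀) (Icc 0 N) := by
    rw [show defect a s₀ = _ from funext (defect_eq s₀)]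
    obtain ⟨h1, h2⟩ := continuousOn_series_flux (continuous_weight ha) (weight_pos ha)
      weight_neg s₀ N
    exact (continuousOn_const.mul h1).sub (h2.div_const _)
  have hNle : defect a s₀ N ≤ 0 := by
    rw [defect_eq, sub_nonpos, le_div_iff₀ (mul_pos hB hT)]
    linarith
  obtain ⟨ν, hν, hν0⟩ := intermediate_value_Icc' hN.le hcont ⟨hNle, h0.le⟩
  exact ⟨ν, lt_of_le_of_ne hν.1 fun e => by rw [← e] at hν0; linarith, hν0⟩

/-- Two positive solutions satisfying the same Robin conditions have a Wronskian vanishing at both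
ends, yet its derivative `(ν₂ - ν₁) B f g` is positive. -/
theorem defect_unique {s₀ : ℝ} (hs₀ : 0 < s₀) {ν₁ ν₂ : ℝ} (h₁ : 0 ≤ ν₁) (h : ν₁ < ν₂)
    (hd₁ : defect a s₀ ν₁ = 0) (hd₂ : defect a s₀ ν₂ = 0) : False := by
  have hW := lt_of_hasDerivWithinAt_pos (x := -s₀) (y := s₀) (by linarith)
    (fun s hs => ((isSol_shoot ha ν₂).isSolOn _).hasDerivWithinAt_wronskian
      ((isSol_shoot ha ν₁).isSolOn _) hs)
    (fun s _ => mul_pos (by linarith) (mul_pos (mul_pos (B_pos ha s)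
      (shoot_pos ha (h₁.trans h.le) s)) (shoot_pos ha h₁ s)))
  simp only [shoot_neg, shootDeriv_neg, B_neg] at hW
  rw [defect, sub_eq_zero] at hd₁ hd₂
  rw [← hd₁, ← hd₂] at hW
  linarith

/-! ### Eigenfunctions and eigenvalues of the Robin problem. -/

theorem IsRadialSolution.isSolOn {s₀ μ : ℝ} {f : ℝ → ℝ} (h : IsRadialSolution a s₀ μ f) :
    ∃ f₁, IsSolOn (Icc (-s₀) s₀) (B a) (fun s => pot a s + -μ) f f₁ ∧
      f₁ s₀ = coth (radius a s₀) * f s₀ ∧ f₁ (-s₀) = -(coth (radius a s₀) * f (-s₀)) := by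
  obtain ⟨f₁, f₂, h1, h2, h3, h4, h5⟩ := h
  refine ⟨f₁, fun s hs => ⟨h1 s hs, ?_⟩, h4, h5⟩
  refine ((hasDerivAt_B ha s).hasDerivWithinAt.mul (h2 s hs)).congr_deriv ?_
  have e := h3 s hs
  have hB := (B_pos ha s).ne'
  rw [(hasDerivAt_B ha s).deriv, normSqII_eq ha] at e
  have e' : f₂ s = -(a * sinh (2 * s) / B a s / B a s * f₁ s) +
      (2 + 1 / B a s ^ 2 - 2 * K a ^ 2 / B a s ^ 4 + -μ) * f s := by linear_combination e
  simp only [e', pot]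
  field_simp
  ring

theorem IsSol.isRadialSolution {s₀ μ : ℝ} {f f₁ : ℝ → ℝ}
    (h : IsSol (B a) (fun s => pot a s + -μ) f f₁)
    (hp : f₁ s₀ = coth (radius a s₀) * f s₀)
    (hm : f₁ (-s₀) = -(coth (radius a s₀) * f (-s₀))) : IsRadialSolution a s₀ μ f := by
  have hd : ∀ s, HasDerivAt f₁ ((pot a s + -μ) * f s - a * sinh (2 * s) / B a s / B a s * f₁ s)
      s := by
    intro s
    have hB := (B_pos ha s).ne'
    have e : f₁ = fun t => B a t * f₁ t / B a t := by
      funext t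
      rw [mul_div_cancel_left₀ _ (B_pos ha t).ne']
    rw [e]
    refine ((h s).2.div (hasDerivAt_B ha s) hB).congr_deriv ?_
    field_simp
  refine ⟨f₁, _, fun s _ => (h s).1.hasDerivWithinAt, fun s _ => (hd s).hasDerivWithinAt,
    fun s _ => ?_, hp, hm⟩
  rw [(hasDerivAt_B ha s).deriv, normSqII_eq ha, pot]
  ring

theorem isRadialSolution_tan₀ {s₀ : ℝ} (h : IsFreeBoundary a s₀) :
    IsRadialSolution a s₀ 0 (tan₀ a) := by
  refine IsSol.isRadialSolution ha (by simpa using isSol_tan₀ ha) (robin_tan₀ ha h) ?_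
  rw [coth_robin_neg, robin_tan₀ ha h, tan₀_neg]
  ring

theorem isRadialSolution_shoot {s₀ ν : ℝ} (h : defect a s₀ ν = 0) :
    IsRadialSolution a s₀ (-ν) (shoot a ν) := by
  rw [defect, sub_eq_zero] at h
  refine IsSol.isRadialSolution ha (by simpa using isSol_shoot ha ν) h.symm ?_
  rw [shootDeriv_neg, shoot_neg, h]

/-- A solution of the radial problem is even if the even solution satisfies the Robin condition,
and odd otherwise. -/
theorem IsRadialSolution.even_or_odd {s₀ ν : ℝ} (hs₀ : 0 < s₀) (hν : 0 ≤ ν) {f : ℝ → ℝ}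
    (h : IsRadialSolution a s₀ (-ν) f) :
    (defect a s₀ ν = 0 → ∃ α, ∀ s ∈ Icc (-s₀) s₀, f s = α * shoot a ν s) ∧
    (defect a s₀ ν ≠ 0 → ∃ k, ∀ s ∈ Icc (-s₀) s₀,
      f s = k * (shoot a ν s * ∫ t in (0 : ℝ)..s, 1 / (B a t * shoot a ν t ^ 2))) := by
  obtain ⟨f₁, hf, hp, hm⟩ := h.isSolOn ha
  rw [neg_neg] at hf
  have hB := B_pos ha s₀
  have hg := shoot_pos ha hν
  obtain ⟨hk, α, hα⟩ := hf.eq_of_pos hs₀ (continuous_B ha) (B_pos ha) (isSol_shoot ha ν) hg rfl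
  -- By the Robin conditions the constant Wronskian with `shoot` equals `B f(s₀) · defect` at `s₀`
  -- and `-B f(-s₀) · defect` at `-s₀`. A nonzero defect therefore forces `f(-s₀) = -f(s₀)`.
  rw [hp] at hk hα
  rw [hm, shoot_neg, shootDeriv_neg, B_neg] at hk
  have hk0 : B a s₀ * (coth (radius a s₀) * f s₀) * shoot a ν s₀ -
      f s₀ * (B a s₀ * shootDeriv a ν s₀) = B a s₀ * f s₀ * defect a s₀ ν := by
    rw [defect]; ring
  rw [hk0] at hk hα
  constructor
  · intro hd
    refine ⟨α, fun s hs => ?_⟩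
    rw [hα s hs, hd]
    ring
  · intro hd
    have hsum : f s₀ + f (-s₀) = 0 := by
      have : B a s₀ * defect a s₀ ν * (f s₀ + f (-s₀)) = 0 := by
        rw [defect] at hk ⊢
        linear_combination -hk
      exact (mul_eq_zero.1 this).resolve_left (mul_ne_zero hB.ne' hd)
    have hJ : (∫ t in (0 : ℝ)..-s₀, 1 / (B a t * shoot a ν t ^ 2)) =
        -∫ t in (0 : ℝ)..s₀, 1 / (B a t * shoot a ν t ^ 2) := by
      have := intervalIntegral.integral_comp_neg (a := 0) (b := s₀)
        (fun t => 1 / (B a t * shoot a ν t ^ 2))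
      simp only [B_neg, shoot_neg, neg_zero] at this
      rw [this, intervalIntegral.integral_symm]
    have hα0 : α = 0 := by
      rw [hα s₀ ⟨by linarith, le_rfl⟩, hα (-s₀) ⟨le_rfl, by linarith⟩, shoot_neg, hJ] at hsum
      have : α * (2 * shoot a ν s₀) = 0 := by linear_combination hsum
      exact (mul_eq_zero.1 this).resolve_right (mul_ne_zero two_ne_zero (hg s₀).ne')
    refine ⟨B a s₀ * f s₀ * defect a s₀ ν, fun s hs => ?_⟩
    rw [hα s hs, hα0]
    ring

theorem odd_integral_pos {ν : ℝ} (hν : 0 ≤ ν) {s : ℝ} (hs : 0 < s) :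
    0 < ∫ t in (0 : ℝ)..s, 1 / (B a t * shoot a ν t ^ 2) := by
  have hc : Continuous fun t => 1 / (B a t * shoot a ν t ^ 2) :=
    continuous_const.div ((continuous_B ha).mul ((continuous_iff_continuousAt.2 fun s =>
      (isSol_shoot ha ν s).1.continuousAt).pow 2)) fun s =>
        (mul_pos (B_pos ha s) (pow_pos (shoot_pos ha hν s) 2)).ne'
  exact intervalIntegral.intervalIntegral_pos_of_pos (hc.intervalIntegrable _ _)
    (fun t => one_div_pos.2 (mul_pos (B_pos ha t) (pow_pos (shoot_pos ha hν t) 2))) hs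

/-- There is no odd eigenfunction with a negative eigenvalue. -/
theorem IsRadialSolution.eq_zero {s₀ ν : ℝ} (hfb : IsFreeBoundary a s₀) (hν : 0 < ν) {f : ℝ → ℝ}
    (h : IsRadialSolution a s₀ (-ν) f) (hd : defect a s₀ ν ≠ 0) :
    ∀ s ∈ Icc (-s₀) s₀, f s = 0 := by
  have hs₀ := hfb.1
  obtain ⟨k, hk⟩ := (h.even_or_odd ha hs₀ hν.le).2 hd
  obtain ⟨f₁, hf, hp, -⟩ := h.isSolOn ha
  rw [neg_neg] at hf
  have hsub : Icc 0 s₀ ⊆ Icc (-s₀) s₀ := Icc_subset_Icc (by linarith) le_rfl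
  by_cases hk0 : k = 0
  · intro s hs
    rw [hk s hs, hk0, zero_mul]
  -- The Wronskian with `tan₀` vanishes at `0`, where both functions do, and at `s₀`, where both
  -- satisfy the Robin condition. Its derivative is `ν B f tan₀`; the factor `k` makes it positive
  -- whatever the sign of `f`.
  have hW := lt_of_hasDerivWithinAt_pos hs₀
    (fun s hs => ((hf.mono hsub).hasDerivWithinAt_wronskian
      ((isSol_tan₀ ha).isSolOn _) hs).const_mul k) (fun s hs => by
        rw [hk s (hsub (Ioo_subset_Icc_self hs))]
        have h1 := odd_integral_pos ha hν.le hs.1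
        have h2 := shoot_pos ha hν.le s
        have h3 := tan₀_pos ha hs.1
        have h4 := B_pos ha s
        have h5 : 0 < k * k := mul_self_pos.2 hk0
        have : 0 < ν * (B a s * (k * k) * (shoot a ν s *
          ∫ t in (0 : ℝ)..s, 1 / (B a t * shoot a ν t ^ 2)) * tan₀ a s) := by positivity
        linarith)
  have hf0 : f 0 = 0 := by
    rw [hk 0 ⟨by linarith, hs₀.le⟩]; simp
  rw [hp, robin_tan₀ ha hfb, hf0, tan₀_zero] at hW
  exfalso
  linarith

theorem defect_eq_zero_of_mem {s₀ ν : ℝ} (hfb : IsFreeBoundary a s₀) (hν : 0 < ν)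
    (h : -ν ∈ radialSpectrum a s₀) : defect a s₀ ν = 0 := by
  by_contra hd
  refine h ((Submodule.eq_bot_iff _).2 ?_)
  rintro g ⟨f, hf, hgf⟩
  funext s
  rw [hgf s, hf.eq_zero ha hfb hν hd s s.2]
  rfl

theorem finrank_shoot {s₀ ν : ℝ} (hfb : IsFreeBoundary a s₀) (hν : 0 < ν)
    (hd : defect a s₀ ν = 0) : Module.finrank ℝ (radialEigenspace a s₀ (-ν)) = 1 := by
  have hs₀ := hfb.1
  refine (finrank_eq_one_iff_of_nonzero' (⟨fun s => shoot a ν s, shoot a ν,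
    isRadialSolution_shoot ha hd, fun _ => rfl⟩ : radialEigenspace a s₀ (-ν)) ?_).2 ?_
  · intro h
    have := congrFun (congrArg Subtype.val h) ⟨0, by linarith, hs₀.le⟩
    exact (shoot_pos ha hν.le 0).ne' this
  · rintro ⟨g, f, hf, hgf⟩
    obtain ⟨α, hα⟩ := (hf.even_or_odd ha hs₀ hν.le).1 hd
    refine ⟨α, Subtype.ext (funext fun s => ?_)⟩
    change α * shoot a ν s = g s
    rw [hgf s, hα s s.2]

/-- The defect at `ν = 0` is positive, so every solution is a multiple of one odd function, and
`tan₀` is a nonzero such multiple. -/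
theorem finrank_zero {s₀ : ℝ} (hfb : IsFreeBoundary a s₀) :
    Module.finrank ℝ (radialEigenspace a s₀ 0) = 1 := by
  have hs₀ := hfb.1
  have hd := (defect_zero_pos ha hfb).ne'
  have hmem : s₀ ∈ Icc (-s₀) s₀ := ⟨by linarith, le_rfl⟩
  have hT := (tan₀_pos ha hs₀).ne'
  have h0 := isRadialSolution_tan₀ ha hfb
  obtain ⟨k₀, hk₀⟩ := (IsRadialSolution.even_or_odd ha hs₀ le_rfl (by rwa [neg_zero])).2 hd
  have hk : k₀ ≠ 0 := by
    rintro rfl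
    exact hT (by rw [hk₀ s₀ hmem, zero_mul])
  refine (finrank_eq_one_iff_of_nonzero' (⟨fun s => tan₀ a s, tan₀ a,
    h0, fun _ => rfl⟩ : radialEigenspace a s₀ 0) ?_).2 ?_
  · intro h
    exact hT (congrFun (congrArg Subtype.val h) ⟨s₀, hmem⟩)
  · rintro ⟨g, f, hf, hgf⟩
    obtain ⟨k, hk'⟩ := (IsRadialSolution.even_or_odd ha hs₀ le_rfl (by rwa [neg_zero])).2 hd
    refine ⟨k / k₀, Subtype.ext (funext fun s => ?_)⟩
    change k / k₀ * tan₀ a s = g s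
    rw [hgf s, hk' s s.2, hk₀ s s.2]
    field_simp

omit ha in
theorem mem_radialSpectrum_of_finrank {s₀ μ : ℝ}
    (h : Module.finrank ℝ (radialEigenspace a s₀ μ) = 1) : μ ∈ radialSpectrum a s₀ := by
  intro hb
  rw [hb, finrank_bot] at h
  exact zero_ne_one h

theorem radial_spectrum {s₀ : ℝ} (hfb : IsFreeBoundary a s₀) :
    ∃ μ₀ : ℝ, μ₀ < 0 ∧
      {μ ∈ radialSpectrum a s₀ | μ < 0} = {μ₀} ∧
      IsLeast {μ ∈ radialSpectrum a s₀ | μ₀ < μ} 0 ∧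
      Module.finrank ℝ (radialEigenspace a s₀ μ₀) = 1 ∧
      Module.finrank ℝ (radialEigenspace a s₀ 0) = 1 := by
  obtain ⟨ν, hν, hd⟩ := exists_defect_eq_zero ha hfb
  have h1 := finrank_shoot ha hfb hν hd
  have h0 := finrank_zero ha hfb
  have huniq : ∀ μ ∈ radialSpectrum a s₀, μ < 0 → μ = -ν := by
    intro μ hμ hlt
    have hd' : defect a s₀ (-μ) = 0 :=
      defect_eq_zero_of_mem ha hfb (by linarith) (by rwa [neg_neg])
    rcases lt_trichotomy (-μ) ν with h | h | h
    · exact (defect_unique ha hfb.1 (by linarith) h hd' hd).elim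
    · linarith
    · exact (defect_unique ha hfb.1 hν.le h hd hd').elim
  refine ⟨-ν, by linarith, ?_, ⟨⟨mem_radialSpectrum_of_finrank h0, by linarith⟩, ?_⟩, h1, h0⟩
  · ext μ
    constructor
    · rintro ⟨hμ, hlt⟩
      exact huniq μ hμ hlt
    · rintro rfl
      exact ⟨mem_radialSpectrum_of_finrank h1, by linarith⟩
  · rintro μ ⟨hμ, hlt⟩
    by_contra! hneg
    exact hlt.ne' (huniq μ hμ hneg)

end

/-! ### The second variation form in mode one -/

/-- The radial form `∫ B (f'² + (2 + 1/B² - |II|²) f²) - coth r · B f²|_∂`. -/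
def radialForm (a s₀ : ℝ) (f f₁ : ℝ → ℝ) : ℝ :=
  (∫ s in (-s₀)..s₀, B a s * (f₁ s ^ 2 + pot a s * f s ^ 2)) -
    coth (radius a s₀) * (B a s₀ * (f s₀ ^ 2 + f (-s₀) ^ 2))

theorem integral_trig (P Q R : ℝ) :
    ∫ θ in (0 : ℝ)..2 * π, (P * cos θ ^ 2 + Q * (sin θ * cos θ) + R * sin θ ^ 2) =
      π * (P + R) := by
  rw [intervalIntegral.integral_add, intervalIntegral.integral_add,
    intervalIntegral.integral_const_mul, intervalIntegral.integral_const_mul,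
    intervalIntegral.integral_const_mul, integral_cos_sq, integral_sin_sq, integral_sin_mul_cos₁]
  · simp; ring
  all_goals exact Continuous.intervalIntegrable (by fun_prop) _ _

theorem integral_sq_trig (x y : ℝ) :
    ∫ θ in (0 : ℝ)..2 * π, (x * cos θ + y * sin θ) ^ 2 = π * (x ^ 2 + y ^ 2) := by
  rw [← integral_trig (x ^ 2) (2 * x * y) (y ^ 2)]
  congr 1
  funext θ
  ring

section
variable {a : ℝ} (ha : 1 / 2 < a)
include ha

theorem continuous_pot : Continuous (pot a) := by
  have h := continuous_B ha
  have h0 : ∀ s, B a s ≠ 0 := fun s => (B_pos ha s).ne'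
  unfold pot
  fun_prop (disch := exact fun s => pow_ne_zero _ (h0 s))

/-- With `dA = B ds dθ`, the mixed `sin θ cos θ` terms integrate to zero, so the form splits into
two radial ones; `∂_θ` contributes the `1/B²` in `pot`. -/
theorem secondVariation_eq {s₀ : ℝ} (hs₀ : 0 < s₀) {u : ℝ → ℝ → ℝ} {f h f₁ h₁ : ℝ → ℝ}
    (hu : ∀ s ∈ Icc (-s₀) s₀, ∀ θ, u s θ = f s * cos θ + h s * sin θ)
    (hf : ContinuousOn f (Icc (-s₀) s₀)) (hh : ContinuousOn h (Icc (-s₀) s₀))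
    (hf₁ : ContinuousOn f₁ (Icc (-s₀) s₀)) (hh₁ : ContinuousOn h₁ (Icc (-s₀) s₀))
    (hdf : ∀ s ∈ Ioo (-s₀) s₀, HasDerivAt f (f₁ s) s)
    (hdh : ∀ s ∈ Ioo (-s₀) s₀, HasDerivAt h (h₁ s) s) :
    secondVariation a s₀ u = π * (radialForm a s₀ f f₁ + radialForm a s₀ h h₁) := by
  have hle : -s₀ ≤ s₀ := by linarith
  have hint : ∀ g g₁ : ℝ → ℝ, ContinuousOn g (Icc (-s₀) s₀) → ContinuousOn g₁ (Icc (-s₀) s₀) →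
      IntervalIntegrable (fun s => B a s * (g₁ s ^ 2 + pot a s * g s ^ 2)) volume (-s₀) s₀ := by
    intro g g₁ hg hg₁
    refine ContinuousOn.intervalIntegrable_of_Icc hle ?_
    exact (continuous_B ha).continuousOn.mul
      ((hg₁.pow 2).add ((continuous_pot ha).continuousOn.mul (hg.pow 2)))
  -- Only the open interval: at the ends, the two-sided `deriv` would depend on values of `u` off
  -- the annulus. The ends are negligible in the integral.
  have hinner : ∀ s ∈ Ioo (-s₀) s₀, (∫ θ in (0 : ℝ)..2 * π,
      (gradSq a u s θ - (normSqII a s θ - 2) * u s θ ^ 2) * √((metric a s θ).det)) =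
      π * (B a s * (f₁ s ^ 2 + pot a s * f s ^ 2) + B a s * (h₁ s ^ 2 + pot a s * h s ^ 2)) := by
    intro s hs
    have hB := B_pos ha s
    have hsI := Ioo_subset_Icc_self hs
    have hp : ∀ θ, partials u s θ =
        ![f₁ s * cos θ + h₁ s * sin θ, -(f s * sin θ) + h s * cos θ] := by
      intro θ
      have e1 : HasDerivAt (fun t => u t θ) (f₁ s * cos θ + h₁ s * sin θ) s := by
        refine (((hdf s hs).mul_const (cos θ)).add
          ((hdh s hs).mul_const (sin θ))).congr_of_eventuallyEq ?_
        filter_upwards [Icc_mem_nhds hs.1 hs.2] with t ht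
        exact hu t ht θ
      have e2 : HasDerivAt (fun t => u s t) (-(f s * sin θ) + h s * cos θ) θ := by
        rw [show (fun t => u s t) = _ from funext (hu s hsI)]
        refine (((hasDerivAt_cos θ).const_mul (f s)).add
          ((hasDerivAt_sin θ).const_mul (h s))).congr_deriv ?_
        ring
      rw [partials, e1.deriv, e2.deriv]
    have hsq : √(B a s ^ 2) = B a s := sqrt_sq hB.le
    set P := (f₁ s ^ 2 + 1 / B a s ^ 2 * h s ^ 2 - (2 * K a ^ 2 / B a s ^ 4 - 2) * f s ^ 2) * B a s
    set Q := (2 * f₁ s * h₁ s - 1 / B a s ^ 2 * (2 * f s * h s) -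
      (2 * K a ^ 2 / B a s ^ 4 - 2) * (2 * f s * h s)) * B a s
    set R := (h₁ s ^ 2 + 1 / B a s ^ 2 * f s ^ 2 - (2 * K a ^ 2 / B a s ^ 4 - 2) * h s ^ 2) * B a s
    calc _ = ∫ θ in (0 : ℝ)..2 * π, (P * cos θ ^ 2 + Q * (sin θ * cos θ) + R * sin θ ^ 2) := by
          congr 1
          funext θ
          simp only [gradSq, hp, metric_inv ha, normSqII_eq ha, det_metric ha, hu s hsI, hsq,
            Fin.sum_univ_two, P, Q, R]
          simp
          ring
      _ = π * (P + R) := integral_trig P Q R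
      _ = _ := by simp only [P, R, pot]; ring
  have hbd : ∀ s, s ∈ Icc (-s₀) s₀ → B a s = B a s₀ → (∫ θ in (0 : ℝ)..2 * π,
      u s θ ^ 2 * √(metric a s θ 1 1)) = π * (B a s₀ * (f s ^ 2 + h s ^ 2)) := by
    intro s hs hBs
    simp only [metric_eq ha, hu s hs, Matrix.of_apply, Matrix.cons_val_one, Matrix.cons_val_fin_one,
      sqrt_sq (B_pos ha s).le]
    rw [intervalIntegral.integral_mul_const, integral_sq_trig, hBs]
    ring
  have hmain : (∫ s in (-s₀)..s₀, ∫ θ in (0 : ℝ)..2 * π,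
      (gradSq a u s θ - (normSqII a s θ - 2) * u s θ ^ 2) * √((metric a s θ).det)) =
      π * ((∫ s in (-s₀)..s₀, B a s * (f₁ s ^ 2 + pot a s * f s ^ 2)) +
        ∫ s in (-s₀)..s₀, B a s * (h₁ s ^ 2 + pot a s * h s ^ 2)) := by
    rw [← intervalIntegral.integral_add (hint f f₁ hf hf₁) (hint h h₁ hh hh₁),
      ← intervalIntegral.integral_const_mul]
    rw [intervalIntegral.integral_of_le hle, intervalIntegral.integral_of_le hle,
      integral_Ioc_eq_integral_Ioo, integral_Ioc_eq_integral_Ioo]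
    exact setIntegral_congr_fun measurableSet_Ioo hinner
  rw [secondVariation, boundaryIntegral, hmain, hbd s₀ ⟨hle, le_rfl⟩ rfl,
    hbd (-s₀) ⟨le_rfl, hle⟩ (B_neg a s₀), radialForm, radialForm]
  ring

/-- Jacobi's argument: the odd zero mode bounds the form from below on functions vanishing at
the centre. -/
theorem half_form_nonneg {s₀ : ℝ} (hfb : IsFreeBoundary a s₀) {f f₁ : ℝ → ℝ}
    (hd : ∀ s ∈ Icc 0 s₀, HasDerivWithinAt f (f₁ s) (Icc 0 s₀) s)
    (hc : ContinuousOn f₁ (Icc 0 s₀)) (h0 : f 0 = 0) :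
    coth (radius a s₀) * (B a s₀ * f s₀ ^ 2) ≤
      ∫ s in (0 : ℝ)..s₀, B a s * (f₁ s ^ 2 + pot a s * f s ^ 2) := by
  have hs₀ := hfb.1
  have hfc : ContinuousOn f (Icc 0 s₀) := fun s hs => (hd s hs).continuousWithinAt
  set T₁ := fun s => A a s * cosh (phi a s) + curv a s * nor₀ a s with hT₁
  have hsol := isSol_tan₀ ha
  -- `F = B tan₀' f² / tan₀` equals the boundary term at `s₀`. Written as `f · (f / tan₀)`, it takes
  -- the value `0` at `s = 0` and is continuous there, since `f / tan₀` has a limit.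
  set F := fun s => B a s * T₁ s * f s * (f s / tan₀ a s) with hF
  have hcB : Continuous fun s => B a s * T₁ s :=
    continuous_iff_continuousAt.2 fun s => (hsol s).2.continuousAt
  have hcT : Continuous (tan₀ a) := continuous_iff_continuousAt.2 fun s => (hsol s).1.continuousAt
  have hT0 : 0 < T₁ 0 := by
    have h1 := A_pos ha 0
    have h2 := K_pos ha
    have h3 := B_pos ha 0
    simp only [hT₁, curv, nor₀, phi_zero, mul_zero, sinh_zero, cosh_zero, sub_zero, mul_one]
    positivity
  have hFc : ContinuousOn F (Icc 0 s₀) := by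
    intro s hs
    rcases hs.1.eq_or_lt with rfl | hpos
    · rw [← continuousWithinAt_sdiff_self]
      have hl : Filter.Tendsto (fun t => f t / tan₀ a t) (nhdsWithin 0 (Icc 0 s₀ \ {0}))
          (nhds (f₁ 0 / T₁ 0)) := by
        have e1 := hasDerivWithinAt_iff_tendsto_slope.1 (hd 0 hs)
        have e2 := hasDerivWithinAt_iff_tendsto_slope.1
          ((hsol 0).1.hasDerivWithinAt (s := Icc 0 s₀))
        -- Both functions vanish at `0`, so `f / tan₀` is the quotient of their slopes.
        refine (e1.div e2 hT0.ne').congr' ?_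
        filter_upwards [self_mem_nhdsWithin] with t ht
        have ht0 : t ≠ 0 := ht.2
        simp only [Pi.div_apply, slope_def_field, h0, tan₀_zero, sub_zero]
        rw [div_div_div_cancel_right₀ ht0]
      have hl2 : Filter.Tendsto (fun t => B a t * T₁ t * f t) (nhdsWithin 0 (Icc 0 s₀ \ {0}))
          (nhds (B a 0 * T₁ 0 * f 0)) :=
        (hcB.continuousWithinAt.mul ((hfc 0 hs).mono sdiff_subset))
      have := hl2.mul hl
      rw [h0, mul_zero, zero_mul] at this
      have hF0 : F 0 = 0 := by simp [hF, h0]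
      rw [ContinuousWithinAt, hF0]
      exact this
    · exact (hcB.continuousWithinAt.mul (hfc s hs)).mul
        ((hfc s hs).div hcT.continuousWithinAt (tan₀_pos ha hpos).ne')
  have key := intervalIntegral.sub_le_integral_of_hasDeriv_right_of_le hs₀.le hFc
    (g' := fun s => B a s * pot a s * f s ^ 2 +
      B a s * T₁ s * (2 * f s * f₁ s * tan₀ a s - f s ^ 2 * T₁ s) / tan₀ a s ^ 2)
    (φ := fun s => B a s * (f₁ s ^ 2 + pot a s * f s ^ 2)) (fun s hs => ?_)
    (ContinuousOn.integrableOn_Icc ((continuous_B ha).continuousOn.mul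
      ((hc.pow 2).add ((continuous_pot ha).continuousOn.mul (hfc.pow 2))))) (fun s hs => ?_)
  · have e0 : F 0 = 0 := by simp [hF, h0]
    have e1 : F s₀ = coth (radius a s₀) * (B a s₀ * f s₀ ^ 2) := by
      have hT := (tan₀_pos ha hs₀).ne'
      have e2 : T₁ s₀ = coth (radius a s₀) * tan₀ a s₀ := robin_tan₀ ha hfb
      simp only [hF, e2]
      field_simp
    rwa [e0, sub_zero, e1] at key
  · have hT := (tan₀_pos ha hs.1).ne'
    have hfs : HasDerivAt f (f₁ s) s :=
      (hd s (Ioo_subset_Icc_self hs)).hasDerivAt (Icc_mem_nhds hs.1 hs.2)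
    have := (((hsol s).2.mul hfs).mul (hfs.div (hsol s).1 hT)).hasDerivWithinAt (s := Ioi s)
    refine this.congr_deriv ?_
    simp only [Pi.mul_apply, Pi.div_apply]
    field_simp
    ring
  · have hT := tan₀_pos ha hs.1
    have hB := B_pos ha s
    -- The integrand exceeds `F'` by exactly this square.
    have : 0 ≤ B a s * (f₁ s - T₁ s * f s / tan₀ a s) ^ 2 := by positivity
    have e : B a s * (f₁ s ^ 2 + pot a s * f s ^ 2) - (B a s * pot a s * f s ^ 2 +
      B a s * T₁ s * (2 * f s * f₁ s * tan₀ a s - f s ^ 2 * T₁ s) / tan₀ a s ^ 2) =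
        B a s * (f₁ s - T₁ s * f s / tan₀ a s) ^ 2 := by
      field_simp
      ring
    linarith

/-- `B` and `pot` are even, so the half-interval estimate applies to both `f(s)` and `f(-s)`. -/
theorem radialForm_nonneg {s₀ : ℝ} (hfb : IsFreeBoundary a s₀) {f f₁ : ℝ → ℝ}
    (hd : ∀ s ∈ Icc (-s₀) s₀, HasDerivWithinAt f (f₁ s) (Icc (-s₀) s₀) s)
    (hc : ContinuousOn f₁ (Icc (-s₀) s₀)) (h0 : f 0 = 0) : 0 ≤ radialForm a s₀ f f₁ := by
  have hs₀ := hfb.1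
  have hfc : ContinuousOn f (Icc (-s₀) s₀) := fun s hs => (hd s hs).continuousWithinAt
  have hsub : Icc 0 s₀ ⊆ Icc (-s₀) s₀ := Icc_subset_Icc (by linarith) le_rfl
  have hsub' : Icc (-s₀) 0 ⊆ Icc (-s₀) s₀ := Icc_subset_Icc le_rfl hs₀.le
  have hmaps : MapsTo (fun s => -s) (Icc 0 s₀) (Icc (-s₀) s₀) := fun s hs =>
    ⟨by linarith [hs.2], by linarith [hs.1]⟩
  have h1 := half_form_nonneg ha hfb (fun s hs => (hd s (hsub hs)).mono hsub) (hc.mono hsub) h0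
  have h2 := half_form_nonneg ha hfb (f := fun s => f (-s)) (f₁ := fun s => -f₁ (-s))
    (fun s hs => by
      have := (hd (-s) (hmaps hs)).scomp s ((hasDerivAt_neg s).hasDerivWithinAt) hmaps
      simpa [Function.comp_def] using this)
    (hc.comp continuous_neg.continuousOn hmaps).neg (by simpa using h0)
  have hneg := intervalIntegral.integral_comp_neg (a := 0) (b := s₀)
    (fun s => B a s * (f₁ s ^ 2 + pot a s * f s ^ 2))
  simp only [B_neg, pot_neg, neg_zero] at hneg
  simp only [neg_sq] at h2
  rw [hneg] at h2
  have hcont := (continuous_B ha).continuousOn.mul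
      ((hc.pow 2).add ((continuous_pot ha).continuousOn.mul (hfc.pow 2)))
  have hadd := intervalIntegral.integral_add_adjacent_intervals (μ := volume)
    ((hcont.mono hsub').intervalIntegrable_of_Icc (by linarith : -s₀ ≤ 0))
    ((hcont.mono hsub).intervalIntegrable_of_Icc hs₀.le)
  rw [radialForm, sub_nonneg]
  refine le_trans (le_of_eq ?_) ((add_le_add h2 h1).trans_eq hadd)
  ring

theorem continuous_tan₁_deriv :
    Continuous fun s => A a s * sinh (phi a s) + curv a s * nor₁ a s := by
  have h : Continuous fun s => B a s * (A a s * sinh (phi a s) + curv a s * nor₁ a s) :=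
    continuous_iff_continuousAt.2 fun s => (isSol_tan₁ ha s).2.continuousAt
  refine (h.div (continuous_B ha) fun s => (B_pos ha s).ne').congr fun s => ?_
  exact mul_div_cancel_left₀ _ (B_pos ha s).ne'

/-- By the equation the integrand is the derivative of `B tan₁' tan₁`. What remains is `2 B tan₁
(tan₁' - coth r tan₁)` at `s₀`, negative by `robin_tan₁_lt`. -/
theorem radialForm_tan₁_neg {s₀ : ℝ} (hfb : IsFreeBoundary a s₀) :
    radialForm a s₀ (tan₁ a) (fun s => A a s * sinh (phi a s) + curv a s * nor₁ a s) < 0 := by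
  have hsol := isSol_tan₁ ha
  set f₁ := fun s => A a s * sinh (phi a s) + curv a s * nor₁ a s with hf₁
  have hc₁ : Continuous f₁ := continuous_tan₁_deriv ha
  have hcont : Continuous fun s => B a s * (f₁ s ^ 2 + pot a s * tan₁ a s ^ 2) :=
    (continuous_B ha).mul ((hc₁.pow 2).add ((continuous_pot ha).mul ((continuous_tan₁ ha).pow 2)))
  have hI : ∫ s in (-s₀)..s₀, B a s * (f₁ s ^ 2 + pot a s * tan₁ a s ^ 2) =
      B a s₀ * f₁ s₀ * tan₁ a s₀ - B a (-s₀) * f₁ (-s₀) * tan₁ a (-s₀) := by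
    refine intervalIntegral.integral_eq_sub_of_hasDerivAt
      (f := fun s => B a s * f₁ s * tan₁ a s) (fun s _ => ?_) (hcont.intervalIntegrable _ _)
    refine ((hsol s).2.mul (hsol s).1).congr_deriv ?_
    ring
  have hodd : f₁ (-s₀) = -f₁ s₀ := by
    simp only [hf₁, curv, A_neg, B_neg, phi_neg, nor₁_neg, sinh_neg]; ring
  rw [radialForm, hI, hodd, tan₁_neg, B_neg]
  have hlt : f₁ s₀ < coth (radius a s₀) * tan₁ a s₀ := robin_tan₁_lt ha hfb
  have h1 := mul_pos (mul_pos (B_pos ha s₀) (tan₁_pos ha s₀)) (sub_pos.2 hlt)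
  linarith

/-! ### Smoothness of the test functions and the mode-one index. -/

theorem contDiff_A : ContDiff ℝ ∞ (A a) := by
  unfold A
  refine ContDiff.sqrt (by fun_prop) fun s => ?_
  linarith [radicand_pos ha s]

theorem contDiff_B : ContDiff ℝ ∞ (B a) := by
  unfold B
  exact ContDiff.sqrt (by fun_prop) fun s => (radicand_pos ha s).ne'

theorem contDiff_phi : ContDiff ℝ ∞ (phi a) := by
  rw [contDiff_infty_iff_deriv]
  refine ⟨fun s => (hasDerivAt_phi ha s).differentiableAt, ?_⟩
  rw [show deriv (phi a) = _ from funext fun s => (hasDerivAt_phi ha s).deriv]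
  exact contDiff_const.div (((contDiff_A ha).pow 2).mul (contDiff_B ha)) fun s =>
    (mul_pos (pow_pos (A_pos ha s) 2) (B_pos ha s)).ne'

theorem contDiff_tan₁ : ContDiff ℝ ∞ (tan₁ a) := by
  have hA := contDiff_A ha
  have hB := contDiff_B ha
  have hphi := contDiff_phi ha
  have hA0 : ∀ s, A a s ≠ 0 := fun s => (A_pos ha s).ne'
  have hB0 : ∀ s, B a s ≠ 0 := fun s => (B_pos ha s).ne'
  have h1 : ContDiff ℝ ∞ fun s : ℝ => a * sinh (2 * s) / A a s :=
    ContDiff.div (by fun_prop) hA hA0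
  have h2 : ContDiff ℝ ∞ fun s : ℝ => K a / (A a s * B a s) :=
    contDiff_const.div (hA.mul hB) fun s => mul_ne_zero (hA0 s) (hB0 s)
  exact (h1.mul (Real.contDiff_sinh.comp hphi)).add (h2.mul (Real.contDiff_cosh.comp hphi))

omit ha in
/-- The functions `(x cos θ + y sin θ) f(s)`. -/
def modeOne (f : ℝ → ℝ) : ℝ × ℝ →ₗ[ℝ] ℝ → ℝ → ℝ where
  toFun p s θ := p.1 * f s * cos θ + p.2 * f s * sin θ
  map_add' p q := by funext s θ; simp only [Prod.fst_add, Prod.snd_add, Pi.add_apply]; ring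
  map_smul' c p := by
    funext s θ
    simp only [Prod.smul_fst, Prod.smul_snd, Pi.smul_apply, smul_eq_mul, RingHom.id_apply]; ring

theorem two_mem_negativeDims {s₀ : ℝ} (hfb : IsFreeBoundary a s₀) : 2 ∈ negativeDims a s₀ := by
  have hinj : Function.Injective (modeOne (tan₁ a)) := by
    rw [← LinearMap.ker_eq_bot, LinearMap.ker_eq_bot']
    intro p hp
    have hT := (tan₁_pos ha 0).ne'
    have h1 := congrFun (congrFun hp 0) 0
    have h2 := congrFun (congrFun hp 0) (π / 2)
    simp [modeOne, hT] at h1 h2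
    exact Prod.ext h1 h2
  refine ⟨LinearMap.range (modeOne (tan₁ a)), inferInstance, ?_, ?_⟩
  · rw [LinearMap.finrank_range_of_inj hinj]; simp
  · rintro _ ⟨p, rfl⟩
    refine ⟨⟨?_, fun s _ θ => ?_⟩, fun s _ => ⟨p.1 * tan₁ a s, p.2 * tan₁ a s, fun θ => rfl⟩,
      fun hne => ?_⟩
    · have h := contDiff_tan₁ ha
      change ContDiffOn ℝ ∞ (fun q : ℝ × ℝ =>
        p.1 * tan₁ a q.1 * cos q.2 + p.2 * tan₁ a q.1 * sin q.2) _
      have h' : ContDiff ℝ ∞ fun q : ℝ × ℝ => tan₁ a q.1 := h.comp contDiff_fst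
      exact (((contDiff_const.mul h').mul (Real.contDiff_cos.comp contDiff_snd)).add
        ((contDiff_const.mul h').mul (Real.contDiff_sin.comp contDiff_snd))).contDiffOn
    · simp [modeOne]
    · have hsol := isSol_tan₁ ha
      set f₁ := fun s => A a s * sinh (phi a s) + curv a s * nor₁ a s with hf₁
      have hc := continuous_tan₁ ha
      have hc₁ : Continuous f₁ := continuous_tan₁_deriv ha
      have hscale : ∀ x : ℝ, radialForm a s₀ (fun s => x * tan₁ a s) (fun s => x * f₁ s) =
          x ^ 2 * radialForm a s₀ (tan₁ a) f₁ := by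
        intro x
        rw [radialForm, radialForm, mul_sub, ← intervalIntegral.integral_const_mul]
        congr 1
        · congr 1
          funext s
          ring
        · ring
      rw [secondVariation_eq ha hfb.1 (u := modeOne (tan₁ a) p) (f := fun s => p.1 * tan₁ a s)
        (h := fun s => p.2 * tan₁ a s) (f₁ := fun s => p.1 * f₁ s) (h₁ := fun s => p.2 * f₁ s)
        (fun s _ θ => rfl) (continuous_const.mul hc).continuousOn
        (continuous_const.mul hc).continuousOn (continuous_const.mul hc₁).continuousOn
        (continuous_const.mul hc₁).continuousOn (fun s _ => (hsol s).1.const_mul _)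
        (fun s _ => (hsol s).1.const_mul _), hscale, hscale, ← add_mul]
      refine mul_neg_of_pos_of_neg pi_pos (mul_neg_of_pos_of_neg ?_ (radialForm_tan₁_neg ha hfb))
      by_contra! hle
      have e1 : p.1 = 0 := by nlinarith [sq_nonneg p.1, sq_nonneg p.2]
      have e2 : p.2 = 0 := by nlinarith [sq_nonneg p.1, sq_nonneg p.2]
      exact hne (by rw [show p = 0 from Prod.ext e1 e2, map_zero])

theorem secondVariation_nonneg {s₀ : ℝ} (hfb : IsFreeBoundary a s₀) {u : ℝ → ℝ → ℝ}
    (hu : IsSmooth s₀ u) (hm : IsModeOne s₀ u) (h0 : u 0 0 = 0) (h1 : u 0 (π / 2) = 0) :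
    0 ≤ secondVariation a s₀ u := by
  have hs₀ := hfb.1
  have hlt : -s₀ < s₀ := by linarith
  have hsm : ∀ θ, ContDiffOn ℝ ∞ (fun s => u s θ) (Icc (-s₀) s₀) := fun θ =>
    hu.1.comp (f := fun s : ℝ => (s, θ)) (by fun_prop) fun s hs => ⟨hs, mem_univ _⟩
  have hd : ∀ θ, ∀ s ∈ Icc (-s₀) s₀, HasDerivWithinAt (fun s => u s θ)
      (derivWithin (fun s => u s θ) (Icc (-s₀) s₀) s) (Icc (-s₀) s₀) s := fun θ s hs =>
    (((hsm θ).differentiableOn (by simp)) s hs).hasDerivWithinAt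
  have hc : ∀ θ, ContinuousOn (derivWithin (fun s => u s θ) (Icc (-s₀) s₀)) (Icc (-s₀) s₀) :=
    fun θ => (hsm θ).continuousOn_derivWithin (uniqueDiffOn_Icc hlt) (by simp)
  -- In mode one, the values at `θ = 0` and `θ = π/2` are the coefficients of `cos θ` and `sin θ`.
  rw [secondVariation_eq ha hs₀ (f := fun s => u s 0) (h := fun s => u s (π / 2))
    (fun s hs θ => ?_) (hsm _).continuousOn (hsm _).continuousOn (hc _) (hc _)
    (fun s hs => (hd _ s (Ioo_subset_Icc_self hs)).hasDerivAt (Icc_mem_nhds hs.1 hs.2))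
    (fun s hs => (hd _ s (Ioo_subset_Icc_self hs)).hasDerivAt (Icc_mem_nhds hs.1 hs.2))]
  · exact mul_nonneg pi_pos.le (add_nonneg (radialForm_nonneg ha hfb (hd _) (hc _) h0)
      (radialForm_nonneg ha hfb (hd _) (hc _) h1))
  · obtain ⟨c, d, hcd⟩ := hm s hs
    simp [hcd]

/-- For the upper bound, on a space of dimension above `2` some `u ≠ 0` has both coefficients zero
at `s = 0`, and there the form is nonnegative. -/
theorem hasModeOneIndex_two {s₀ : ℝ} (hfb : IsFreeBoundary a s₀) : HasModeOneIndex a s₀ 2 := by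
  refine ⟨two_mem_negativeDims ha hfb, ?_⟩
  rintro n ⟨W, hfin, rfl, hW⟩
  by_contra! hlt
  let ev : W →ₗ[ℝ] ℝ × ℝ :=
    { toFun := fun u => (u.1 0 0, u.1 0 (π / 2))
      map_add' := fun _ _ => rfl
      map_smul' := fun _ _ => rfl }
  have hker : LinearMap.ker ev ≠ ⊥ := LinearMap.ker_ne_bot_of_finrank_lt (by simpa using hlt)
  obtain ⟨u, hu, hne⟩ := Submodule.exists_mem_ne_zero_of_ne_bot hker
  obtain ⟨hs, hm, hneg⟩ := hW u u.2
  have hu' : (u.1 0 0, u.1 0 (π / 2)) = ((0, 0) : ℝ × ℝ) := hu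
  rw [Prod.mk.injEq] at hu'
  have := secondVariation_nonneg ha hfb hs hm hu'.1 hu'.2
  have := hneg fun h => hne (Subtype.ext h)
  linarith

end

end SphericalCatenoid

end

open SphericalCatenoid
theorem corollary3p3 (a : ℝ) (ha : 1 / 2 < a) :
    (∃! s₀ : ℝ, IsFreeBoundary a s₀) ∧
    ∀ s₀ : ℝ, IsFreeBoundary a s₀ →
      HasModeOneIndex a s₀ 2 ∧
      ∃ μ₀ : ℝ, μ₀ < 0 ∧
        {μ ∈ radialSpectrum a s₀ | μ < 0} = {μ₀} ∧
        IsLeast {μ ∈ radialSpectrum a s₀ | μ₀ < μ} 0 ∧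
        Module.finrank ℝ (radialEigenspace a s₀ μ₀) = 1 ∧
        Module.finrank ℝ (radialEigenspace a s₀ 0) = 1 :=
  ⟨existsUnique_isFreeBoundary ha, fun _ h => ⟨hasModeOneIndex_two ha h, radial_spectrum ha h⟩⟩
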